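/- Let $p$ be a prime and let $(S,\mathfrak n)$ be a regular local ring of characteristic $p$ that is $F$-finite, i.e. $F_*S$ is a finitely generated $S$-module. Let $J\subsetneq S$ be a proper ideal and let $R=S/J$, a local ring of dimension $d$ with residue field $k$. Here $F^e_*R$ denotes $R$ regarded as an $R$-module via the $e$-th iterate of Frobenius, $\alpha(R)=\log_p[k:k^p]$, and the $e$-th $F$-splitting number $a_e(R)$ is the maximal number of direct summands isomorphic to $R$ in a direct sum decomposition of $F^e_*R$ as an $R$-module. For an ideal $I$ of $S$, $I^{[p^e]}$ is the ideal generated by the $p^e$-th powers of the elements of $I$, and $I:I'=\{x\in S : xI'\subseteq I\}$. Then for every integer $e>0$ the following lengths are finite and $$\frac{a_e(R)}{p^{e\alpha(R)}}=\ell_S\Bigl(S\big/\bigl(\mathfrak n^{[p^e]}:(J^{[p^e]}:J)\bigr)\Bigr)=\ell_S\Bigl((J^{[p^e]}:J)\big/\bigl((J^{[p^e]}:J)\cap\mathfrak n^{[p^e]}\bigr)\Bigr).$$ Consequently the $F$-signature $s(R)=\lim_{e\to\infty} a_e(R)/p^{e(d+\alpha(R))}$ exists and $$s(R)=\lim_{e\to\infty}\frac{1}{p^{ed}}\,\ell_S\Bigl(S\big/\bigl(\mathfrak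 n^{[p^e]}:(J^{[p^e]}:J)\bigr)\Bigr)=\lim_{e\to\infty}\frac{1}{p^{ed}}\,\ell_S\Bigl((J^{[p^e]}:J)\big/\bigl((J^{[p^e]}:J)\cap\mathfrak n^{[p^e]}\bigr)\Bigr).$$ -/

import Mathlib

open Filter Topology IsLocalRing

/-- A nonzero quotient of a ring of prime characteristic `p` has characteristic `p`. -/
instance instCharPQuotientOfNontrivial {R : Type*} [CommRing R] (p : ℕ) [Fact p.Prime] [CharP R p]
    (I : Ideal R) [Nontrivial (R ⧸ I)] : CharP (R ⧸ I) p := by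
  refine (CharP.charP_iff_prime_eq_zero Fact.out).2 ?_
  rw [← map_natCast (Ideal.Quotient.mk I) p, CharP.cast_eq_zero, map_zero]

/-- The residue field of a local ring of prime characteristic `p` has characteristic `p`. -/
instance instCharPResidueField {R : Type*} [CommRing R] [IsLocalRing R] (p : ℕ) [Fact p.Prime]
    [CharP R p] : CharP (ResidueField R) p := by
  refine (CharP.charP_iff_prime_eq_zero Fact.out).2 ?_
  rw [← map_natCast (residue R) p, CharP.cast_eq_zero, map_zero]

/-- A nonzero quotient of a local ring is local. -/
instance instIsLocalRingQuotientOfNontrivial {R : Type*} [CommRing R] [IsLocalRing R]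
    (I : Ideal R) [Nontrivial (R ⧸ I)] : IsLocalRing (R ⧸ I) :=
  IsLocalRing.of_surjective' (Ideal.Quotient.mk I) Ideal.Quotient.mk_surjective

/-- `F^e_* R`: the abelian group `R`, regarded as an `R`-module by restriction of scalars along
the `e`-th iterate of Frobenius (see `FrobeniusPushforward.smul_def`). -/
def FrobeniusPushforward (_p _e : ℕ) (R : Type*) : Type _ := R

namespace FrobeniusPushforward

variable (p e : ℕ) (R : Type*) [CommRing R]

instance : AddCommGroup (FrobeniusPushforward p e R) := inferInstanceAs (AddCommGroup R)

/-- The element `F^e_* x` of `F^e_* R` corresponding to `x`. -/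
def of : R ≃+ FrobeniusPushforward p e R := AddEquiv.refl R

variable [ExpChar R p]

instance : Module R (FrobeniusPushforward p e R) :=
  Module.compHom R (iterateFrobenius R p e)

theorem smul_def (r x : R) : r • of p e R x = of p e R (r ^ p ^ e * x) := rfl

end FrobeniusPushforward

/-- A ring `R` of characteristic `p` is `F`-finite if `F_* R` is a finitely generated
`R`-module. -/
def IsFFinite (p : ℕ) (R : Type*) [CommRing R] [ExpChar R p] : Prop :=
  Module.Finite R (FrobeniusPushforward p 1 R)

/-- `α(R) = log_p [k : k ^ p]`, where `k` is the residue field of the local ring `R`. -/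
noncomputable def frobeniusAlpha (p : ℕ) [Fact p.Prime] (R : Type*) [CommRing R] [IsLocalRing R]
    [CharP R p] : ℝ :=
  Real.logb p (Module.finrank (frobenius (ResidueField R) p).fieldRange (ResidueField R))

/-- The `e`-th `F`-splitting number `a_e(R)`: the maximal number of summands isomorphic to `R` in a
direct sum decomposition of `F^e_* R` as an `R`-module, that is, the largest `a` for which
`F^e_* R ≃ R ^ a ⊕ M` for some `R`-module `M`. (Such an `M` is a submodule of `F^e_* R`, so it
can be taken in the universe of `R`.) -/
noncomputable def fSplittingNumber.{u} (p e : ℕ) (R : Type u) [CommRing R] [ExpChar R p] : ℕ :=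
  sSup {a : ℕ | ∃ (M : Type u) (_ : AddCommGroup M) (_ : Module R M),
    Nonempty (FrobeniusPushforward p e R ≃ₗ[R] (Fin a → R) × M)}

/-- `s` is the `F`-signature of the local ring `R`: with `d = dim R`, the sequence
`a_e(R) / p ^ (e (d + α(R)))` converges to `s` as `e → ∞`. -/
def IsFSignature (p : ℕ) [Fact p.Prime] (R : Type*) [CommRing R] [IsLocalRing R] [CharP R p]
    (s : ℝ) : Prop :=
  ∃ d : ℕ, ringKrullDim R = d ∧
    Tendsto (fun e : ℕ => (fSplittingNumber p e R : ℝ) /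
      (p : ℝ) ^ ((e : ℝ) * ((d : ℝ) + frobeniusAlpha p R))) atTop (𝓝 s)

/-- The Frobenius power `I ^ [p ^ e]`: the ideal generated by the `p ^ e`-th powers of the elements
of `I`. -/
def frobeniusPower (p e : ℕ) {S : Type*} [CommRing S] [ExpChar S p] (I : Ideal S) : Ideal S :=
  I.map (iterateFrobenius S p e)

/-- The ideal `J ^ [p ^ e] : J`. -/
def frobeniusColon (p e : ℕ) {S : Type*} [CommRing S] [ExpChar S p] (J : Ideal S) : Ideal S :=
  (frobeniusPower p e J).colon (J : Set S)

/-- The ideal `𝔫 ^ [p ^ e] : (J ^ [p ^ e] : J)`, where `𝔫` is the maximal ideal of `S`. -/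
def fedderIdeal (p e : ℕ) {S : Type*} [CommRing S] [IsLocalRing S] [ExpChar S p] (J : Ideal S) :
    Ideal S :=
  (frobeniusPower p e (maximalIdeal S)).colon (frobeniusColon p e J : Set S)

/-- The `S`-module `(J ^ [p ^ e] : J) / ((J ^ [p ^ e] : J) ∩ 𝔫 ^ [p ^ e])`. -/
abbrev FedderQuotient (p e : ℕ) {S : Type*} [CommRing S] [IsLocalRing S] [ExpChar S p]
    (J : Ideal S) : Type _ :=
  frobeniusColon p e J ⧸
    (frobeniusColon p e J ⊓ frobeniusPower p e (maximalIdeal S)).submoduleOf (frobeniusColon p e J)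

/-!
By Kunz's theorem `F^e_* S` is free over the regular local ring `S`, and since `S / 𝔫^[p^e]` has a
one-dimensional socle, `Hom_S(F^e_* S, S)` is generated by a single functional as a module over
`F^e_* S`. Hence the functionals on `F^e_* R`, where `R = S / J`, are induced by the multiples of
that functional by elements of `J^[p^e] : J` (Fedder), and the ideal `I_e` of the elements of `R`
not generating a free summand of `F^e_* R` pulls back to `𝔫^[p^e] : (J^[p^e] : J)`. The splitting
number `a_e(R)` is the colength of `I_e` times `[k : k^p]^e`, which is the first equality; the
second is duality in the Gorenstein Artinian ring `S / 𝔫^[p^e]`.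

For the limit (Tucker), let first `R` be a domain. Up to modules killed by some `c ≠ 0`, `F_* R` is
free, of rank at most `[k : k^p] p^d` as counting independent elements in `F^e_* R` shows. Since
`I_e^[p] ≤ I_{e+1}`, the normalised lengths `u_e = ℓ(R / I_e) / p^{ed}` satisfy
`u_{e+1} ≤ u_e + C / p^e` and converge. If `R` is not a domain, then `I_e` is the unit ideal or
contains two minimal primes, so that `R / I_e` has length `O(p^{e(d-1)})` and the limit is `0`.
-/

section QuotientsOfLocalRings

variable {R : Type*} [CommRing R] [IsLocalRing R] (I : Ideal R) [Nontrivial (R ⧸ I)]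

theorem comap_mk_maximalIdeal :
    (maximalIdeal (R ⧸ I)).comap (Ideal.Quotient.mk I) = maximalIdeal R :=
  have := Ideal.Quotient.mk_surjective (I := I).isLocalHom
  ((local_hom_TFAE (Ideal.Quotient.mk I)).out 0 4).1 this

theorem map_mk_maximalIdeal :
    (maximalIdeal R).map (Ideal.Quotient.mk I) = maximalIdeal (R ⧸ I) := by
  rw [← comap_mk_maximalIdeal I, Ideal.map_comap_of_surjective _ Ideal.Quotient.mk_surjective]

end QuotientsOfLocalRings

section RegularLocalRings

open RingTheory.Sequence

theorem exists_mem_maximalIdeal_notMem_sq_notMem_minimalPrimes (S : Type*) [CommRing S]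
    [IsRegularLocalRing S] (h : maximalIdeal S ≠ ⊥) :
    ∃ x ∈ maximalIdeal S, x ∉ maximalIdeal S ^ 2 ∧ ∀ P ∈ minimalPrimes S, x ∉ P := by
  classical
  have hfin := minimalPrimes.finite_of_isNoetherianRing S
  have not_le_sq : ¬ maximalIdeal S ≤ maximalIdeal S ^ 2 := fun hle =>
    h (Submodule.eq_bot_of_le_smul_of_le_jacobson_bot (maximalIdeal S) _
      (IsNoetherian.noetherian _) (by simpa [sq] using hle) (maximalIdeal_le_jacobson _))
  have not_le_minimal : ∀ P ∈ minimalPrimes S, ¬ maximalIdeal S ≤ P := by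
    intro P hP hle
    obtain rfl : P = maximalIdeal S :=
      le_antisymm (le_maximalIdeal (Ideal.IsMinimalPrime.isPrime hP).ne_top) hle
    have hheight : (maximalIdeal S).height = 0 := Ideal.height_eq_zero_iff.2 hP
    have hdim := IsRegularLocalRing.spanFinrank_maximalIdeal (R := S)
    rw [← maximalIdeal_height_eq_ringKrullDim, hheight] at hdim
    exact h ((Submodule.spanFinrank_eq_zero_iff_eq_bot (IsNoetherian.noetherian _)).1
      (by exact_mod_cast hdim))
  have avoidance := (Ideal.subset_union_prime
    (s := insert (maximalIdeal S ^ 2) hfin.toFinset) (f := id) (I := maximalIdeal S)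
    (maximalIdeal S ^ 2) (maximalIdeal S ^ 2) fun P hP hne _ => Ideal.IsMinimalPrime.isPrime
      (hfin.mem_toFinset.1 (Finset.mem_of_mem_insert_of_ne hP hne))).not.2 <| by
    rintro ⟨P, hP, hle⟩
    rcases Finset.mem_insert.1 hP with rfl | hP
    · exact not_le_sq hle
    · exact not_le_minimal P (hfin.mem_toFinset.1 hP) hle
  obtain ⟨x, hx, hx'⟩ := Set.not_subset.1 avoidance
  simp only [Set.mem_iUnion, not_exists] at hx'
  exact ⟨x, hx, hx' _ (by simp), fun P hP => hx' P (by simp [hP])⟩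

section ParameterQuotient

variable {R : Type*} [CommRing R] [IsLocalRing R] [IsNoetherianRing R] {x : R}

theorem exists_span_insert_eq_maximalIdeal (hx : x ∈ maximalIdeal R)
    (hx2 : x ∉ maximalIdeal R ^ 2) :
    ∃ t : Finset R, t.card + 1 = (maximalIdeal R).spanFinrank ∧
      Ideal.span (insert x (t : Set R)) = maximalIdeal R := by
  classical
  obtain ⟨t, ht, hspan⟩ := Submodule.FG.exists_span_finset_card_eq_spanFinrank
    (IsNoetherian.noetherian (maximalIdeal R))
  obtain ⟨a, -, ha⟩ := Submodule.mem_span_finset.1 (hspan.ge hx)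
  obtain ⟨y, hyt, hy⟩ : ∃ y ∈ t, IsUnit (a y) := by
    by_contra! h
    refine hx2 (ha ▸ Ideal.sum_mem _ fun y hy => ?_)
    rw [sq, smul_eq_mul]
    exact Ideal.mul_mem_mul ((mem_maximalIdeal _).2 (h y hy)) (hspan ▸ Submodule.subset_span hy)
  refine ⟨t.erase y, by rw [Finset.card_erase_add_one hyt, ht], le_antisymm ?_ ?_⟩
  · refine Ideal.span_le.2 (Set.insert_subset hx fun z hz => ?_)
    exact hspan ▸ Submodule.subset_span (Finset.mem_of_mem_erase hz)
  · refine hspan ▸ Submodule.span_le.2 fun z hz => ?_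
    by_cases hzy : z = y
    · have hsum : a y * y = x - ∑ z ∈ t.erase y, a z • z := by
        rw [← ha, ← Finset.add_sum_erase t _ hyt]; simp
      rw [hzy, SetLike.mem_coe, ← Ideal.unit_mul_mem_iff_mem _ hy, hsum]
      exact Submodule.sub_mem _ (Ideal.subset_span (Set.mem_insert _ _))
        (Submodule.sum_mem _ fun w hw => Submodule.smul_mem _ _ (Ideal.subset_span (Or.inr hw)))
    · exact Ideal.subset_span (Or.inr (Finset.mem_erase.2 ⟨hzy, hz⟩))

theorem spanFinrank_maximalIdeal_quotient_add_one_le [Nontrivial (R ⧸ Ideal.span {x})]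
    (hx : x ∈ maximalIdeal R) (hx2 : x ∉ maximalIdeal R ^ 2) :
    (maximalIdeal (R ⧸ Ideal.span {x})).spanFinrank + 1 ≤ (maximalIdeal R).spanFinrank := by
  classical
  obtain ⟨t, ht, hspan⟩ := exists_span_insert_eq_maximalIdeal hx hx2
  have hgen : maximalIdeal (R ⧸ Ideal.span {x}) =
      Ideal.span (t.image (Ideal.Quotient.mk (Ideal.span {x})) : Set _) := by
    rw [← map_mk_maximalIdeal, ← hspan, Ideal.span_insert, Ideal.map_sup,
      Ideal.map_quotient_self, bot_sup_eq, Ideal.map_span, Finset.coe_image]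
  rw [hgen, ← ht]
  refine Nat.add_le_add_right
    ((Submodule.spanFinrank_span_le_ncard_of_finite (Finset.finite_toSet _)).trans ?_) 1
  rw [Set.ncard_coe_finset]
  exact Finset.card_image_le

/-- A minimal prime `P ⊆ (x)` with `x ∉ P` satisfies `P = xP`, hence vanishes by Nakayama. -/
theorem isDomain_of_isPrime_span_singleton (hprime : (Ideal.span {x}).IsPrime)
    (hx : ∀ P ∈ minimalPrimes R, x ∉ P) : IsDomain R := by
  obtain ⟨P, hP, hPx⟩ := Ideal.exists_minimalPrimes_le (I := (⊥ : Ideal R))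
    (J := Ideal.span {x}) bot_le
  have hPprime : P.IsPrime := Ideal.IsMinimalPrime.isPrime hP
  have hPbot : P = ⊥ := by
    refine Submodule.eq_bot_of_le_smul_of_le_jacobson_bot (Ideal.span {x}) _
      (IsNoetherian.noetherian _) (fun z hz => ?_)
      ((le_maximalIdeal hprime.ne_top).trans (maximalIdeal_le_jacobson _))
    obtain ⟨r, rfl⟩ := Ideal.mem_span_singleton'.1 (hPx hz)
    rw [mul_comm, smul_eq_mul]
    exact Ideal.mul_mem_mul (Ideal.mem_span_singleton_self x)
      ((hPprime.mem_or_mem hz).resolve_right (hx P hP))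
  rw [hPbot] at hPprime
  exact IsDomain.of_bot_isPrime R

end ParameterQuotient

theorem isRegularLocalRing_quotient_span_singleton {S : Type*} [CommRing S]
    [IsRegularLocalRing S] {x : S} (hx : x ∈ maximalIdeal S) (hx2 : x ∉ maximalIdeal S ^ 2) :
    IsRegularLocalRing (S ⧸ Ideal.span {x}) := by
  have : Nontrivial (S ⧸ Ideal.span {x}) :=
    Ideal.Quotient.nontrivial_iff.2 (Ideal.span_singleton_ne_top hx)
  refine .of_spanFinrank_maximalIdeal_le _ ?_
  have hdim : ringKrullDim S ≤ ringKrullDim (S ⧸ Ideal.span {x}) + (1 : ℕ) := by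
    have := ringKrullDim_le_ringKrullDim_quotient_add_encard ({x} : Set S) (by
      rw [IsLocalRing.ringJacobson_eq_maximalIdeal]; simpa using hx)
    simpa using this
  rw [← IsRegularLocalRing.spanFinrank_maximalIdeal] at hdim
  have hle : (((maximalIdeal (S ⧸ Ideal.span {x})).spanFinrank + 1 : ℕ) : WithBot ℕ∞) ≤
      ringKrullDim (S ⧸ Ideal.span {x}) + (1 : ℕ) :=
    (Nat.cast_le.2 (spanFinrank_maximalIdeal_quotient_add_one_le hx hx2)).trans hdim
  push_cast at hle
  exact (ENat.WithBot.add_le_add_natCast_right_iff (c := 1)).1 (by simpa using hle)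

theorem isDomain_of_isRegularLocalRing (S : Type*) [CommRing S] [IsRegularLocalRing S] :
    IsDomain S := by
  induction hn : (maximalIdeal S).spanFinrank using Nat.strong_induction_on generalizing S with
  | _ n ih =>
    by_cases h : maximalIdeal S = ⊥
    · exact ((isField_iff_maximalIdeal_eq (R := S)).2 h).isDomain
    obtain ⟨x, hx, hx2, hxP⟩ := exists_mem_maximalIdeal_notMem_sq_notMem_minimalPrimes S h
    have := isRegularLocalRing_quotient_span_singleton hx hx2
    have hlt := spanFinrank_maximalIdeal_quotient_add_one_le hx hx2
    have := ih _ (hn ▸ Nat.lt_of_succ_le hlt) (S ⧸ Ideal.span {x}) rfl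
    exact isDomain_of_isPrime_span_singleton ((Ideal.Quotient.isDomain_iff_prime _).1 this) hxP

theorem isWeaklyRegular_cons_of_quotient {R : Type*} [CommRing R] {x : R}
    (hx : IsSMulRegular R x) {L : List R}
    (hL : IsWeaklyRegular (R ⧸ Ideal.span {x}) (L.map (Ideal.Quotient.mk (Ideal.span {x})))) :
    IsWeaklyRegular R (x :: L) := by
  refine (isWeaklyRegular_cons_iff R x L).2 ⟨hx, ?_⟩
  refine ((Submodule.quotEquivOfEq _ _ ?_).isWeaklyRegular_congr L).2
    ((isWeaklyRegular_map_algebraMap_iff (R ⧸ Ideal.span {x}) (R ⧸ Ideal.span {x}) L).1 hL)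
  rw [← Submodule.ideal_span_singleton_smul, smul_eq_mul, Ideal.mul_top]

theorem exists_isWeaklyRegular_ofList_eq_maximalIdeal (S : Type*) [CommRing S]
    [IsRegularLocalRing S] :
    ∃ L : List S, IsWeaklyRegular S L ∧ Ideal.ofList L = maximalIdeal S := by
  induction hn : (maximalIdeal S).spanFinrank using Nat.strong_induction_on generalizing S with
  | _ n ih =>
    by_cases h : maximalIdeal S = ⊥
    · exact ⟨[], .nil _ _, by rw [h, Ideal.ofList_nil]⟩
    obtain ⟨x, hx, hx2, -⟩ := exists_mem_maximalIdeal_notMem_sq_notMem_minimalPrimes S h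
    have := isRegularLocalRing_quotient_span_singleton hx hx2
    have hlt := spanFinrank_maximalIdeal_quotient_add_one_le hx hx2
    obtain ⟨L, hL, hLm⟩ := ih _ (hn ▸ Nat.lt_of_succ_le hlt) (S ⧸ Ideal.span {x}) rfl
    obtain ⟨L, rfl⟩ : ∃ L' : List S, L'.map (Ideal.Quotient.mk (Ideal.span {x})) = L :=
      List.map_surjective_iff.2 Ideal.Quotient.mk_surjective L
    have := isDomain_of_isRegularLocalRing S
    have hx0 : x ≠ 0 := fun h => hx2 (h ▸ zero_mem _)
    refine ⟨x :: L, isWeaklyRegular_cons_of_quotient (fun a b hab => mul_left_cancel₀ hx0 hab) hL,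
      ?_⟩
    rw [← comap_mk_maximalIdeal (Ideal.span {x}), ← hLm, ← Ideal.map_ofList,
      Ideal.comap_map_of_surjective _ Ideal.Quotient.mk_surjective, ← RingHom.ker_eq_comap_bot,
      Ideal.mk_ker, Ideal.ofList_cons, sup_comm]

end RegularLocalRings

section SocleGenerators

open RingTheory.Sequence

/-- The class of `u` modulo `I` is nonzero and lies in every nonzero ideal of `S ⧸ I`. For an
Artinian local ring `S ⧸ I`, this says that the socle is simple and generated by `u`, so that
`S ⧸ I` is Gorenstein. -/
def IsSocleGenerator {S : Type*} [CommRing S] (I : Ideal S) (u : S) : Prop :=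
  u ∉ I ∧ ∀ s ∉ I, u ∈ I ⊔ Ideal.span {s}

theorem isSocleGenerator_maximalIdeal_one (S : Type*) [CommRing S] [IsLocalRing S] :
    IsSocleGenerator (maximalIdeal S) 1 := by
  refine ⟨(Ideal.ne_top_iff_one _).1 (maximalIdeal.isMaximal S).ne_top, fun s hs => ?_⟩
  rw [Ideal.span_singleton_eq_top.2 (notMem_maximalIdeal.1 hs), sup_top_eq]
  trivial

theorem mem_sup_span_singleton_iff {S : Type*} [CommRing S] {I : Ideal S} {y z : S} :
    z ∈ I ⊔ Ideal.span {y} ↔ ∃ t, z - t * y ∈ I := by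
  rw [sup_comm, Ideal.mem_span_singleton_sup]
  constructor
  · rintro ⟨t, b, hb, rfl⟩
    exact ⟨t, by simpa using hb⟩
  · rintro ⟨t, ht⟩
    exact ⟨t, _, ht, by ring⟩

theorem mul_mem_sup_span_singleton_mul {S : Type*} [CommRing S] {I : Ideal S} {y z : S} (c : S)
    (h : z ∈ I ⊔ Ideal.span {y}) : c * z ∈ I ⊔ Ideal.span {c * y} := by
  obtain ⟨t, ht⟩ := mem_sup_span_singleton_iff.1 h
  refine mem_sup_span_singleton_iff.2 ⟨t, ?_⟩
  convert I.mul_mem_left c ht using 1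
  ring

theorem IsSocleGenerator.sup_span_pow {S : Type*} [CommRing S] {I : Ideal S} {x u : S}
    (hx : ∀ r, x * r ∈ I → r ∈ I) (h : IsSocleGenerator (I ⊔ Ideal.span {x}) u) (a : ℕ) :
    IsSocleGenerator (I ⊔ Ideal.span {x ^ (a + 1)}) (x ^ a * u) := by
  induction a with
  | zero => simpa using h
  | succ a ih =>
    refine ⟨fun hmem => ih.1 ?_, fun s hs => ?_⟩
    · obtain ⟨t, ht⟩ := mem_sup_span_singleton_iff.1 hmem
      refine mem_sup_span_singleton_iff.2 ⟨t, hx _ ?_⟩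
      convert ht using 1
      ring
    by_cases hsa : s ∈ I ⊔ Ideal.span {x ^ (a + 1)}
    · obtain ⟨r, hr⟩ := mem_sup_span_singleton_iff.1 hsa
      have hrx : r ∉ I ⊔ Ideal.span {x} := by
        intro hmem
        obtain ⟨t, ht⟩ := mem_sup_span_singleton_iff.1 hmem
        refine hs (mem_sup_span_singleton_iff.2 ⟨t, ?_⟩)
        convert I.add_mem hr (I.mul_mem_left (x ^ (a + 1)) ht) using 1
        ring
      obtain ⟨t, ht⟩ := mem_sup_span_singleton_iff.1 (h.2 r hrx)
      refine mem_sup_span_singleton_iff.2 ⟨t, ?_⟩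
      convert Ideal.sub_mem _ (mul_mem_sup_span_singleton_mul (x ^ (a + 1)) ht)
        (Ideal.mem_sup_left (I.mul_mem_left t hr)) using 1
      · rw [pow_succ x (a + 1)]
      · ring
    · obtain ⟨t, ht⟩ := mem_sup_span_singleton_iff.1 (ih.2 s hsa)
      refine mem_sup_span_singleton_iff.2 ⟨x * t, ?_⟩
      convert mul_mem_sup_span_singleton_mul x ht using 1
      · rw [pow_succ' x (a + 1)]
      · ring

variable {S : Type*} [CommRing S] [IsLocalRing S] [IsNoetherianRing S]

theorem isWeaklyRegular_append_singleton_pow {x : S} {L : List S}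
    (h : IsWeaklyRegular S (x :: L)) (hm : ∀ r ∈ x :: L, r ∈ maximalIdeal S) (a : ℕ) :
    IsWeaklyRegular S (L ++ [x ^ a]) ∧ ∀ r, x * r ∈ Ideal.ofList L → r ∈ Ideal.ofList L := by
  have hperm : IsWeaklyRegular S (L ++ [x]) := isWeaklyRegular_of_perm_of_subset_maximalIdeal h
    (List.perm_append_comm (l₁ := [x])) hm
  rw [isWeaklyRegular_append_iff, isWeaklyRegular_singleton_iff] at hperm
  refine ⟨(isWeaklyRegular_append_iff _ _ _).2 ⟨hperm.1, (isWeaklyRegular_singleton_iff _ _).2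
    (hperm.2.pow a)⟩, fun r hr => ?_⟩
  have hzero := hperm.2.right_eq_zero_of_smul (x := Submodule.Quotient.mk r) (by
    rw [← Submodule.Quotient.mk_smul, Submodule.Quotient.mk_eq_zero]
    simpa using hr)
  rw [Submodule.Quotient.mk_eq_zero] at hzero
  simpa using hzero

theorem isWeaklyRegular_append_map_pow (q : ℕ) (L₁ : List S) :
    ∀ L₂ : List S, IsWeaklyRegular S (L₁ ++ L₂) → (∀ r ∈ L₁ ++ L₂, r ∈ maximalIdeal S) →
      (∃ u, IsSocleGenerator (Ideal.ofList (L₁ ++ L₂)) u) →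
      IsWeaklyRegular S (L₂ ++ L₁.map (· ^ (q + 1))) ∧
        ∃ u, IsSocleGenerator (Ideal.ofList (L₂ ++ L₁.map (· ^ (q + 1)))) u := by
  induction L₁ with
  | nil => intro L₂ h _ hu; simpa using And.intro h hu
  | cons x L₁ ih =>
    rintro L₂ h hm ⟨u, hu⟩
    obtain ⟨hreg, hcancel⟩ := isWeaklyRegular_append_singleton_pow h hm (q + 1)
    have := ih (L₂ ++ [x ^ (q + 1)]) (by simpa using hreg) (fun r hr => ?_) ⟨x ^ q * u, ?_⟩
    · simpa using this
    · simp only [List.mem_append, List.mem_singleton] at hr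
      rcases hr with hr | hr | rfl
      · exact hm _ (by simp [hr])
      · exact hm _ (by simp [hr])
      · exact Ideal.pow_mem_of_mem _ (hm x (by simp)) _ (by omega)
    · rw [← List.append_assoc, Ideal.ofList_append, Ideal.ofList_singleton]
      refine IsSocleGenerator.sup_span_pow hcancel ?_ q
      rwa [List.cons_append, Ideal.ofList_cons, sup_comm] at hu

theorem exists_regularParameters_isSocleGenerator_pow (S : Type*) [CommRing S]
    [IsRegularLocalRing S] : ∃ L : List S, Ideal.ofList L = maximalIdeal S ∧
      ∀ q ≠ 0, IsWeaklyRegular S (L.map (· ^ q)) ∧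
        ∃ u, IsSocleGenerator (Ideal.ofList (L.map (· ^ q))) u := by
  obtain ⟨L, hL, hLm⟩ := exists_isWeaklyRegular_ofList_eq_maximalIdeal S
  refine ⟨L, hLm, fun q hq => ?_⟩
  obtain ⟨q, rfl⟩ := Nat.exists_eq_succ_of_ne_zero hq
  have := isWeaklyRegular_append_map_pow q L []
    (by rwa [List.append_nil])
    (fun r hr => hLm.le (Ideal.subset_span (by rwa [List.append_nil] at hr)))
    ⟨1, by simpa [hLm] using isSocleGenerator_maximalIdeal_one S⟩
  simpa using this

end SocleGenerators

section FreeModules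

open RingTheory.Sequence

theorem free_of_isWeaklyRegular_of_ofList_eq_maximalIdeal (n : ℕ) : ∀ (A : Type*) [CommRing A]
    [IsLocalRing A] [IsNoetherianRing A] (M : Type*) [AddCommGroup M] [Module A M]
    [Module.Finite A M] (L : List A), L.length = n → Ideal.ofList L = maximalIdeal A →
      IsWeaklyRegular M L → Module.Free A M := by
  induction n with
  | zero =>
    intro A _ _ _ M _ _ _ L hn hm _
    rw [List.length_eq_zero_iff.1 hn, Ideal.ofList_nil] at hm
    let := ((isField_iff_maximalIdeal_eq (R := A)).2 hm.symm).toField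
    exact Module.Free.of_divisionRing A M
  | succ n ih =>
    intro A _ _ _ M _ _ _ L hn hm hL
    obtain ⟨x, L, rfl⟩ := List.exists_cons_of_length_eq_add_one hn
    have hx : x ∈ maximalIdeal A := hm ▸ Ideal.subset_span (by simp)
    have hnt : Nontrivial (A ⧸ Ideal.span {x}) := Ideal.Quotient.nontrivial_iff.2
      (Ideal.span_singleton_ne_top hx)
    rw [isWeaklyRegular_cons_iff'] at hL
    have := Module.finitePresentation_of_finite A M
    rw [← Module.free_quotSMulTop_iff_free (R := A) (M := M) (x := x)
      (maximalIdeal_le_jacobson _ hx) hL.1]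
    have : Module.Finite (A ⧸ Ideal.span {x}) (QuotSMulTop x M) :=
      Module.Finite.of_restrictScalars_finite A _ _
    refine ih (A ⧸ Ideal.span {x}) (QuotSMulTop x M) _ (by simpa using hn) ?_ hL.2
    rw [← Ideal.map_ofList, ← map_mk_maximalIdeal, ← hm, Ideal.ofList_cons, Ideal.map_sup,
      Ideal.map_quotient_self, bot_sup_eq]

end FreeModules

section FreeRank

universe u v

/-- The submodule of the elements of `M` that generate no free direct summand of `M`. -/
def nonsplittingSubmodule (A : Type u) [CommRing A] [IsLocalRing A] (M : Type v) [AddCommGroup M]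
    [Module A M] : Submodule A M where
  carrier := {x | ∀ φ : M →ₗ[A] A, φ x ∈ maximalIdeal A}
  add_mem' hx hy φ := by rw [map_add]; exact Ideal.add_mem _ (hx φ) (hy φ)
  zero_mem' φ := by simp
  smul_mem' a x hx φ := by rw [map_smul]; exact Ideal.mul_mem_left _ _ (hx φ)

/-- The numbers `a` such that `M` has a direct summand isomorphic to `A ^ a`. As in
`fSplittingNumber`, the complement is taken in the universe of `M`. -/
def freeSummandRanks (A : Type u) [CommRing A] (M : Type v) [AddCommGroup M] [Module A M] : Set ℕ :=
  {a : ℕ | ∃ (N : Type v) (_ : AddCommGroup N) (_ : Module A N),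
    Nonempty (M ≃ₗ[A] (Fin a → A) × N)}

variable {A : Type u} [CommRing A] {M : Type v} [AddCommGroup M] [Module A M]

theorem bddAbove_freeSummandRanks [Nontrivial A] [Module.Finite A M] :
    BddAbove (freeSummandRanks A M) := by
  obtain ⟨n, f, hf⟩ := Module.Finite.exists_fin' A M
  refine ⟨n, ?_⟩
  rintro a ⟨N, _, _, ⟨e⟩⟩
  simpa using card_le_of_surjective A ((LinearMap.fst A (Fin a → A) N ∘ₗ e.toLinearMap) ∘ₗ f)
    (((LinearMap.fst_surjective (R := A) (M := Fin a → A) (M₂ := N)).comp e.surjective).comp hf)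

theorem zero_mem_freeSummandRanks : 0 ∈ freeSummandRanks A M :=
  ⟨M, inferInstance, inferInstance, ⟨LinearEquiv.uniqueProd.symm⟩⟩

/-- The decomposition `M = A x ⊕ ker φ` for a functional `φ` with `φ x = 1`. -/
def equivProdKerOfApplyEqOne (φ : M →ₗ[A] A) (x : M) (hx : φ x = 1) :
    M ≃ₗ[A] A × LinearMap.ker φ where
  toFun y := (φ y, ⟨y - φ y • x, by simp [hx]⟩)
  invFun z := z.1 • x + z.2
  map_add' y z := by ext <;> simp [add_smul]; abel
  map_smul' a y := by ext <;> simp [smul_sub, mul_smul]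
  left_inv y := by simp
  right_inv z := by
    have : φ z.2 = 0 := z.2.2
    ext <;> simp [hx, this]

theorem succ_mem_freeSummandRanks {a : ℕ} {N : Type v} [AddCommGroup N] [Module A N]
    (e : M ≃ₗ[A] (Fin a → A) × N) {φ : N →ₗ[A] A} {x : N} (hx : IsUnit (φ x)) :
    a + 1 ∈ freeSummandRanks A M := by
  obtain ⟨c, hc⟩ := hx.exists_left_inv
  exact ⟨LinearMap.ker φ, inferInstance, inferInstance, ⟨e ≪≫ₗ
    (LinearEquiv.prodCongr (LinearEquiv.refl A _)
      (equivProdKerOfApplyEqOne φ (c • x) (by simpa using hc))) ≪≫ₗ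
    (LinearEquiv.prodAssoc A _ _ _).symm ≪≫ₗ
    LinearEquiv.prodCongr (LinearEquiv.prodComm A _ _ ≪≫ₗ
      Fin.consLinearEquiv A (fun _ : Fin (a + 1) => A)) (LinearEquiv.refl A _)⟩⟩

variable [IsLocalRing A]

theorem mem_nonsplittingSubmodule_iff_of_equiv {ι : Type*} [Finite ι] {N : Type*}
    [AddCommGroup N] [Module A N] (e : M ≃ₗ[A] (ι → A) × N)
    (hN : ∀ (φ : N →ₗ[A] A) x, φ x ∈ maximalIdeal A) {x : M} :
    x ∈ nonsplittingSubmodule A M ↔ ∀ i, (e x).1 i ∈ maximalIdeal A := by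
  classical
  have := Fintype.ofFinite ι
  refine ⟨fun h i => h (LinearMap.proj i ∘ₗ LinearMap.fst A (ι → A) N ∘ₗ e.toLinearMap),
    fun h φ => ?_⟩
  have hφ : φ x = (φ ∘ₗ e.symm.toLinearMap ∘ₗ LinearMap.inl A _ _) (e x).1 +
      (φ ∘ₗ e.symm.toLinearMap ∘ₗ LinearMap.inr A _ _) (e x).2 := by
    simp only [LinearMap.comp_apply, LinearMap.inl_apply, LinearMap.inr_apply, ← map_add]
    simp
  rw [hφ, LinearMap.pi_apply_eq_sum_univ]
  exact Ideal.add_mem _ (Ideal.sum_mem _ fun i _ => Ideal.mul_mem_right _ _ (h i)) (hN _ _)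

theorem length_quotient_nonsplittingSubmodule [Module.Finite A M] :
    Module.length A (M ⧸ nonsplittingSubmodule A M) = (sSup (freeSummandRanks A M) : ℕ) := by
  obtain ⟨N, _, _, ⟨e⟩⟩ := Nat.sSup_mem ⟨0, zero_mem_freeSummandRanks⟩
    (bddAbove_freeSummandRanks (A := A) (M := M))
  have no_split : ∀ (φ : N →ₗ[A] A) x, φ x ∈ maximalIdeal A := by
    intro φ x
    by_contra hx
    have := le_csSup bddAbove_freeSummandRanks
      (succ_mem_freeSummandRanks e (notMem_maximalIdeal.1 hx))
    omega
  generalize sSup (freeSummandRanks A M) = a at e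
  let f : M →ₗ[A] (Fin a → A ⧸ maximalIdeal A) :=
    (LinearMap.pi fun i => (maximalIdeal A).mkQ ∘ₗ LinearMap.proj i) ∘ₗ
      LinearMap.fst A (Fin a → A) N ∘ₗ e.toLinearMap
  have hf : Function.Surjective f := by
    intro y
    choose z hz using fun i => Ideal.Quotient.mk_surjective (y i)
    exact ⟨e.symm (z, 0), funext fun i => by simpa [f] using hz i⟩
  have hker : LinearMap.ker f = nonsplittingSubmodule A M := by
    ext x
    rw [mem_nonsplittingSubmodule_iff_of_equiv e no_split]
    simp [f, funext_iff, Ideal.Quotient.eq_zero_iff_mem]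
  rw [← hker, (f.quotKerEquivOfSurjective hf).length_eq, Module.length_pi_of_fintype]
  have : IsSimpleModule A (A ⧸ maximalIdeal A) :=
    isSimpleModule_iff_isCoatom.2 (maximalIdeal.isMaximal A).out
  simp

/-- The nonsplitting submodule of an `A`-algebra `B`, as an ideal of `B`. -/
def algebraNonsplittingIdeal (A : Type*) [CommRing A] [IsLocalRing A] (B : Type*) [CommRing B]
    [Algebra A B] : Ideal B where
  __ := nonsplittingSubmodule A B
  smul_mem' b _ hx φ := hx (φ ∘ₗ LinearMap.mulLeft A b)

theorem mem_algebraNonsplittingIdeal {A : Type*} [CommRing A] [IsLocalRing A] {B : Type*}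
    [CommRing B] [Algebra A B] {x : B} :
    x ∈ algebraNonsplittingIdeal A B ↔ ∀ φ : B →ₗ[A] A, φ x ∈ maximalIdeal A := Iff.rfl

theorem length_quotient_algebraNonsplittingIdeal (A : Type*) [CommRing A] [IsLocalRing A]
    (B : Type*) [CommRing B] [Algebra A B] [Module.Finite A B] :
    Module.length A (B ⧸ algebraNonsplittingIdeal A B) = (sSup (freeSummandRanks A B) : ℕ) := by
  rw [← length_quotient_nonsplittingSubmodule]
  exact (Submodule.Quotient.restrictScalarsEquiv A (algebraNonsplittingIdeal A B)).symm.length_eq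

end FreeRank

section DualGenerators

variable {S B ι : Type*} [CommRing S] [CommRing B] [Algebra S B]

/-- The functional `T` generates the `B`-module `Hom_S(B, S)`. -/
def IsDualGenerator (T : B →ₗ[S] S) : Prop :=
  ∀ ψ : B →ₗ[S] S, ∃ c : B, ∀ y, ψ y = T (c * y)

theorem apply_mem_of_mem_map_algebraMap (ψ : B →ₗ[S] S) {I : Ideal S} {y : B}
    (hy : y ∈ I.map (algebraMap S B)) : ψ y ∈ I := by
  have h : y ∈ I • (⊤ : Submodule S B) := by rw [Ideal.smul_top_eq_map]; exact hy
  refine Submodule.smul_induction_on h (fun r hr n _ => ?_) fun x y hx hy => ?_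
  · rw [map_smul]; exact I.mul_mem_right _ hr
  · rw [map_add]; exact I.add_mem hx hy

theorem mem_map_algebraMap_iff_forall_apply_mem [Module.Free S B] [Module.Finite S B]
    {I : Ideal S} {y : B} :
    y ∈ I.map (algebraMap S B) ↔ ∀ ψ : B →ₗ[S] S, ψ y ∈ I := by
  refine ⟨fun hy ψ => apply_mem_of_mem_map_algebraMap ψ hy, fun h => ?_⟩
  let b := Module.Free.chooseBasis S B
  rw [← b.sum_repr y]
  refine Ideal.sum_mem _ fun i _ => ?_
  rw [Algebra.smul_def]
  exact Ideal.mul_mem_right _ _ (Ideal.mem_map_of_mem _ (h (b.coord i)))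

theorem isDualGenerator_of_isUnit_det [Fintype ι] [DecidableEq ι] (b : Module.Basis ι S B)
    {T : B →ₗ[S] S} (hdet : IsUnit (Matrix.of fun i j => T (b i * b j)).det) :
    IsDualGenerator T := by
  intro ψ
  set G : Matrix ι ι S := Matrix.of fun i j => T (b i * b j) with hG
  set v := G⁻¹.mulVec fun i => ψ (b i) with hv
  have hGv : G.mulVec v = fun i => ψ (b i) := by
    rw [hv, Matrix.mulVec_mulVec, Matrix.mul_nonsing_inv _ hdet, Matrix.one_mulVec]
  refine ⟨∑ i, v i • b i, fun y => ?_⟩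
  suffices ψ = T ∘ₗ LinearMap.mulLeft S (∑ i, v i • b i) from congrArg (· y) this
  refine b.ext fun i => ?_
  rw [← congrFun hGv i, LinearMap.comp_apply, LinearMap.mulLeft_apply, Finset.sum_mul, map_sum,
    Matrix.mulVec, dotProduct]
  refine Finset.sum_congr rfl fun j _ => ?_
  rw [smul_mul_assoc, map_smul, smul_eq_mul, mul_comm, mul_comm (b j), hG, Matrix.of_apply]

variable [IsLocalRing S]

/-- A nonzero vector in the kernel of the Gram matrix modulo `𝔫` would lift to an element
`c ∉ 𝔫B` with `T (Bc) ⊆ 𝔫`. -/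
theorem isUnit_det_of_forall_exists_apply_mul_notMem [Fintype ι] [DecidableEq ι]
    (b : Module.Basis ι S B) {T : B →ₗ[S] S}
    (hT : ∀ c ∉ (maximalIdeal S).map (algebraMap S B), ∃ y, T (y * c) ∉ maximalIdeal S) :
    IsUnit (Matrix.of fun i j => T (b i * b j)).det := by
  by_contra hdet
  set G : Matrix ι ι S := Matrix.of fun i j => T (b i * b j) with hG
  have hdet0 : ((residue S).mapMatrix G).det = 0 := by
    rw [← RingHom.map_det, residue_eq_zero_iff]
    exact (mem_maximalIdeal _).2 hdet
  obtain ⟨v, hv0, hv⟩ := Matrix.exists_mulVec_eq_zero_iff.2 hdet0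
  choose w hw using fun i => residue_surjective (v i)
  have hc : ∑ i, w i • b i ∉ (maximalIdeal S).map (algebraMap S B) := by
    refine fun h => hv0 (funext fun i => ?_)
    have hwi := apply_mem_of_mem_map_algebraMap (b.coord i) h
    rw [b.coord_apply, b.repr_sum_self] at hwi
    rw [← hw, Pi.zero_apply, residue_eq_zero_iff]
    exact hwi
  have hTb : ∀ i, T (b i * ∑ i, w i • b i) ∈ maximalIdeal S := by
    intro i
    have hvi := congrFun hv i
    rw [Pi.zero_apply, Matrix.mulVec, dotProduct] at hvi
    rw [← residue_eq_zero_iff, Finset.mul_sum, map_sum, map_sum, ← hvi]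
    refine Finset.sum_congr rfl fun j _ => ?_
    rw [mul_smul_comm, map_smul, smul_eq_mul, map_mul, hw, mul_comm]
    simp [hG]
  obtain ⟨y, hy⟩ := hT _ hc
  refine hy ?_
  rw [← b.sum_repr y, Finset.sum_mul, map_sum]
  refine Ideal.sum_mem _ fun i _ => ?_
  rw [smul_mul_assoc, map_smul]
  exact Ideal.mul_mem_left _ _ (hTb i)

theorem IsSocleGenerator.exists_isDualGenerator [Module.Free S B] [Module.Finite S B] {u : B}
    (hu : IsSocleGenerator ((maximalIdeal S).map (algebraMap S B)) u) :
    ∃ T : B →ₗ[S] S, IsDualGenerator T := by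
  classical
  obtain ⟨T, hT⟩ : ∃ T : B →ₗ[S] S, T u ∉ maximalIdeal S := by
    by_contra! h
    exact hu.1 (mem_map_algebraMap_iff_forall_apply_mem.2 h)
  refine ⟨T, isDualGenerator_of_isUnit_det (Module.Free.chooseBasis S B)
    (isUnit_det_of_forall_exists_apply_mul_notMem _ fun c hc => ?_)⟩
  obtain ⟨y, hy⟩ := mem_sup_span_singleton_iff.1 (hu.2 c hc)
  refine ⟨y, fun hyc => hT ?_⟩
  have := Ideal.add_mem _ (apply_mem_of_mem_map_algebraMap T hy) hyc
  rwa [← map_add, sub_add_cancel] at this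

end DualGenerators

section Fedder

variable {S B R B' : Type*} [CommRing S] [CommRing B] [Algebra S B] [CommRing R] [CommRing B']
  {ρ : S →+* R} {π : B →+* B'}

theorem mem_colon_ker_iff [Module.Free S B] [Module.Finite S B] {T : B →ₗ[S] S}
    (hT : IsDualGenerator T) {c : B} :
    c ∈ ((RingHom.ker ρ).map (algebraMap S B)).colon (RingHom.ker π : Set B) ↔
      ∀ y ∈ RingHom.ker π, ρ (T (c * y)) = 0 := by
  refine ⟨fun hc y hy => apply_mem_of_mem_map_algebraMap T (Submodule.mem_colon.1 hc y hy),
    fun h => Submodule.mem_colon.2 fun y hy =>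
      mem_map_algebraMap_iff_forall_apply_mem.2 fun ψ => ?_⟩
  obtain ⟨d, hd⟩ := hT ψ
  rw [hd, RingHom.mem_ker, smul_eq_mul, mul_left_comm]
  exact h _ (Ideal.mul_mem_left _ d hy)

variable [Algebra R B']

theorem map_smul_of_map_algebraMap (hcomm : ∀ s, π (algebraMap S B s) = algebraMap R B' (ρ s))
    (s : S) (y : B) : π (s • y) = ρ s • π y := by
  rw [Algebra.smul_def, map_mul, hcomm, Algebra.smul_def]

theorem exists_apply_map_eq_map_apply (hρ : Function.Surjective ρ) (hπ : Function.Surjective π)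
    (hcomm : ∀ s, π (algebraMap S B s) = algebraMap R B' (ρ s)) {ψ : B →ₗ[S] S}
    (hψ : ∀ y ∈ RingHom.ker π, ρ (ψ y) = 0) :
    ∃ φ : B' →ₗ[R] R, ∀ y, φ (π y) = ρ (ψ y) := by
  choose σ hσ using hπ
  have hψσ : ∀ y, ρ (ψ (σ (π y))) = ρ (ψ y) := fun y => by
    rw [← sub_eq_zero, ← map_sub, ← map_sub]
    exact hψ _ (by rw [RingHom.mem_ker, map_sub, hσ, sub_self])
  exact ⟨{
    toFun := fun y => ρ (ψ (σ y))
    map_add' := fun y z => by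
      have := hψσ (σ y + σ z)
      rw [map_add, hσ, hσ] at this
      rw [this, map_add, map_add]
    map_smul' := fun r y => by
      obtain ⟨s, rfl⟩ := hρ r
      have := hψσ (s • σ y)
      rw [map_smul_of_map_algebraMap hcomm, hσ] at this
      rw [this, map_smul, smul_eq_mul, map_mul, RingHom.id_apply, smul_eq_mul] }, hψσ⟩

theorem exists_map_apply_eq_apply_map [Module.Free S B] [Module.Finite S B]
    (hρ : Function.Surjective ρ)
    (hcomm : ∀ s, π (algebraMap S B s) = algebraMap R B' (ρ s)) (φ : B' →ₗ[R] R) :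
    ∃ ψ : B →ₗ[S] S, ∀ y, ρ (ψ y) = φ (π y) := by
  let b := Module.Free.chooseBasis S B
  choose σ hσ using hρ
  refine ⟨b.constr S fun i => σ (φ (π (b i))), fun y => ?_⟩
  rw [← b.sum_repr y]
  simp only [map_sum, map_smul_of_map_algebraMap hcomm, map_smul, smul_eq_mul, map_mul]
  exact Finset.sum_congr rfl fun i _ => by rw [b.constr_basis, hσ]

/-- Fedder's argument: the functionals on `B'` are induced by the functionals `y ↦ T (c * y)`
with `c` in the inner colon ideal. -/
theorem comap_algebraNonsplittingIdeal [IsLocalRing S] [IsLocalRing R] [Module.Free S B]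
    [Module.Finite S B] {T : B →ₗ[S] S} (hT : IsDualGenerator T) (hρ : Function.Surjective ρ)
    (hπ : Function.Surjective π) (hcomm : ∀ s, π (algebraMap S B s) = algebraMap R B' (ρ s)) :
    (algebraNonsplittingIdeal R B').comap π = ((maximalIdeal S).map (algebraMap S B)).colon
      (((RingHom.ker ρ).map (algebraMap S B)).colon (RingHom.ker π : Set B) : Set B) := by
  have := hρ.isLocalHom
  have hmem : ∀ s, ρ s ∈ maximalIdeal R ↔ s ∈ maximalIdeal S := fun s => by
    rw [mem_maximalIdeal, mem_maximalIdeal, mem_nonunits_iff, mem_nonunits_iff, isUnit_map_iff]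
  ext x
  rw [Ideal.mem_comap, mem_algebraNonsplittingIdeal, Submodule.mem_colon]
  refine ⟨fun h c hc => mem_map_algebraMap_iff_forall_apply_mem.2 fun ψ => ?_, fun h φ => ?_⟩
  · obtain ⟨φ, hφ⟩ := exists_apply_map_eq_map_apply hρ hπ hcomm
      (ψ := ψ ∘ₗ LinearMap.mulRight S c) fun y hy => by
        have hcy := Submodule.mem_colon.1 hc y hy
        rw [smul_eq_mul, mul_comm] at hcy
        exact apply_mem_of_mem_map_algebraMap ψ hcy
    rw [← hmem]
    exact hφ x ▸ h φ
  · obtain ⟨ψ, hψ⟩ := exists_map_apply_eq_apply_map hρ hcomm φ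
    obtain ⟨c, hc⟩ := hT ψ
    have hcolon := (mem_colon_ker_iff (ρ := ρ) (π := π) hT).2 fun y hy => by
      rw [← hc, hψ, RingHom.mem_ker.1 hy, map_zero]
    rw [← hψ, hmem, hc, mul_comm]
    exact apply_mem_of_mem_map_algebraMap T (h c hcolon)

end Fedder

section Duality

theorem length_le_add_of_exact {R M N P : Type*} [CommRing R] [AddCommGroup M] [Module R M]
    [AddCommGroup N] [Module R N] [AddCommGroup P] [Module R P] {f : N →ₗ[R] M} {g : M →ₗ[R] P}
    (H : Function.Exact f g) :
    Module.length R M ≤ Module.length R N + Module.length R P := by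
  rw [Module.length_eq_add_of_exact (LinearMap.range f).subtype g.rangeRestrict
    (Submodule.subtype_injective _) g.surjective_rangeRestrict
    (by rw [LinearMap.exact_iff, Submodule.range_subtype, LinearMap.ker_rangeRestrict,
      LinearMap.exact_iff.1 H])]
  exact add_le_add (Module.length_le_of_surjective _ f.surjective_rangeRestrict)
    (Module.length_le_of_injective _ (Submodule.subtype_injective _))

theorem length_quotient_ker_le {R M N : Type*} [CommRing R] [AddCommGroup M] [Module R M]
    [AddCommGroup N] [Module R N] (f : M →ₗ[R] N) :
    Module.length R (M ⧸ LinearMap.ker f) ≤ Module.length R N :=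
  Module.length_le_of_injective ((LinearMap.ker f).liftQ f le_rfl)
    (LinearMap.ker_eq_bot.1 (Submodule.ker_liftQ_eq_bot _ _ _ le_rfl))

theorem length_quotient_eq_add {R M : Type*} [CommRing R] [AddCommGroup M] [Module R M]
    (N P : Submodule R M) :
    Module.length R (M ⧸ P) =
      Module.length R (N ⧸ (N ⊓ P).submoduleOf N) + Module.length R (M ⧸ N ⊔ P) := by
  refine Module.length_eq_add_of_exact
    (Submodule.mapQ ((N ⊓ P).submoduleOf N) P N.subtype fun x hx => hx.2)
    (Submodule.factor (le_sup_right (a := N))) ?_ (Submodule.factor_surjective _) fun y => ?_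
  · rw [← LinearMap.ker_eq_bot, eq_bot_iff]
    intro x hx
    obtain ⟨x, rfl⟩ := Submodule.Quotient.mk_surjective _ x
    exact (Submodule.Quotient.mk_eq_zero _).2 ⟨x.2, (Submodule.Quotient.mk_eq_zero P).1 hx⟩
  · obtain ⟨y, rfl⟩ := Submodule.Quotient.mk_surjective _ y
    constructor
    · intro hy
      obtain ⟨c, hc, n, hn, rfl⟩ := Submodule.mem_sup.1 ((Submodule.Quotient.mk_eq_zero _).1 hy)
      exact ⟨Submodule.Quotient.mk ⟨c, hc⟩, (Submodule.Quotient.eq _).2 (by simpa using hn)⟩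
    · rintro ⟨x, hx⟩
      obtain ⟨x, rfl⟩ := Submodule.Quotient.mk_surjective _ x
      rw [← hx]
      exact (Submodule.Quotient.mk_eq_zero _).2 (Submodule.mem_sup_left x.2)

variable {S : Type*} [CommRing S] {I : Ideal S} {u : S} {N : Type*} [AddCommGroup N] [Module S N]

theorem IsSocleGenerator.exists_apply_eq_mk (hu : IsSocleGenerator I u) {φ : N →ₗ[S] S ⧸ I}
    (hφ : φ ≠ 0) : ∃ n ≠ 0, φ n = Ideal.Quotient.mk I u := by
  obtain ⟨n, hn⟩ := DFunLike.ne_iff.1 hφ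
  obtain ⟨s, hs⟩ := Ideal.Quotient.mk_surjective (φ n)
  obtain ⟨t, ht⟩ := mem_sup_span_singleton_iff.1
    (hu.2 s fun h => hn (by rw [← hs, Ideal.Quotient.eq_zero_iff_mem.2 h, LinearMap.zero_apply]))
  have htn : φ (t • n) = Ideal.Quotient.mk I u := by
    rw [map_smul, ← hs, Ideal.Quotient.eq.2 ht]
    rfl
  refine ⟨t • n, fun h => hu.1 (Ideal.Quotient.eq_zero_iff_mem.1 ?_), htn⟩
  rw [← htn, h, map_zero]

theorem IsSocleGenerator.length_linearMap_le_one (hu : IsSocleGenerator I u)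
    [IsSimpleModule S N] : Module.length S (N →ₗ[S] S ⧸ I) ≤ 1 := by
  rcases subsingleton_or_nontrivial (N →ₗ[S] S ⧸ I)
  · simp
  have : IsSimpleModule S (N →ₗ[S] S ⧸ I) := by
    refine isSimpleModule_iff_toSpanSingleton_surjective.2 ⟨inferInstance, fun φ hφ ψ => ?_⟩
    by_cases hψ : ψ = 0
    · exact ⟨0, by simp [hψ]⟩
    obtain ⟨m, -, hm⟩ := hu.exists_apply_eq_mk hφ
    obtain ⟨n, hn0, hn⟩ := hu.exists_apply_eq_mk hψ
    have generates := IsSimpleModule.toSpanSingleton_surjective S hn0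
    obtain ⟨b, rfl⟩ := generates m
    refine ⟨b, LinearMap.ext fun x => ?_⟩
    obtain ⟨r, rfl⟩ := generates x
    simp only [LinearMap.toSpanSingleton_apply, map_smul, LinearMap.smul_apply] at hm ⊢
    rw [hm, hn]
  exact Module.length_eq_one_iff.2 this |>.le

theorem IsSocleGenerator.length_linearMap_le (hu : IsSocleGenerator I u) (N : Type*)
    [AddCommGroup N] [Module S N] : Module.length S (N →ₗ[S] S ⧸ I) ≤ Module.length S N := by
  by_cases hN : Module.length S N = ⊤
  · exact hN ▸ le_top
  rw [← ne_eq, Module.length_ne_top_iff] at hN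
  induction hN with
  | of_subsingleton => simp
  | @of_simple_quotient M _ _ P _ _ ih =>
    rw [Module.length_eq_add_of_exact P.subtype P.mkQ P.subtype_injective P.mkQ_surjective
      (LinearMap.exact_subtype_mkQ P), add_comm,
      Module.length_eq_one_iff.2 ‹IsSimpleModule S (M ⧸ P)›]
    refine (length_le_add_of_exact (f := LinearMap.lcomp S (S ⧸ I) P.mkQ)
      (g := LinearMap.lcomp S (S ⧸ I) P.subtype) ?_).trans
      (add_le_add hu.length_linearMap_le_one ih)
    intro φ
    constructor
    · intro hφ
      have hP : P ≤ LinearMap.ker φ := fun x hx => LinearMap.congr_fun hφ ⟨x, hx⟩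
      exact ⟨P.liftQ φ hP, P.liftQ_mkQ φ hP⟩
    · rintro ⟨ψ, rfl⟩
      ext x
      exact (congrArg ψ ((Submodule.Quotient.mk_eq_zero P).2 x.2)).trans (map_zero ψ)

theorem IsSocleGenerator.length_quotient_colon_le (hu : IsSocleGenerator I u) (C : Ideal S) :
    Module.length S (S ⧸ I.colon (C : Set S)) ≤
      Module.length S (C ⧸ (C ⊓ I).submoduleOf C) := by
  refine le_trans ?_ (hu.length_linearMap_le _)
  let ι : (C ⧸ (C ⊓ I).submoduleOf C) →ₗ[S] S ⧸ I := Submodule.mapQ _ I C.subtype fun x hx => hx.2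
  let m := LinearMap.toSpanSingleton S _ ι
  have hker : LinearMap.ker m = I.colon (C : Set S) := by
    ext s
    rw [LinearMap.mem_ker, Submodule.mem_colon]
    refine ⟨fun h c hc => ?_, fun h => ?_⟩
    · exact Ideal.Quotient.eq_zero_iff_mem.1
        (LinearMap.congr_fun h (Submodule.Quotient.mk ⟨c, hc⟩))
    · ext ⟨c, hc⟩
      exact Ideal.Quotient.eq_zero_iff_mem.2 (h c hc)
  exact hker ▸ length_quotient_ker_le m

theorem IsSocleGenerator.length_colon_quotient_le (hu : IsSocleGenerator I u) (C : Ideal S) :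
    Module.length S (I.colon (C : Set S) ⧸
      (I.colon (C : Set S) ⊓ I).submoduleOf (I.colon (C : Set S))) ≤
      Module.length S (S ⧸ C ⊔ I) := by
  refine le_trans ?_ (hu.length_linearMap_le _)
  have hle : C ⊔ I ≤ LinearMap.ker (LinearMap.toSpanSingleton S (I.colon (C : Set S) →ₗ[S] S ⧸ I)
      (I.mkQ ∘ₗ (I.colon (C : Set S)).subtype)) := by
    refine sup_le (fun c hc => LinearMap.ext fun x => ?_) fun c hc => LinearMap.ext fun x => ?_
    · have hx := Submodule.mem_colon.1 x.2 c hc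
      rw [smul_eq_mul, mul_comm] at hx
      exact Ideal.Quotient.eq_zero_iff_mem.2 hx
    · exact Ideal.Quotient.eq_zero_iff_mem.2 (I.mul_mem_right _ hc)
  let m := (Submodule.liftQ _ _ hle).flip
  have hm (x : I.colon (C : Set S)) (s : S) :
      m x (Submodule.Quotient.mk s) = Ideal.Quotient.mk I (s * x) := rfl
  have hker : LinearMap.ker m =
      (I.colon (C : Set S) ⊓ I).submoduleOf (I.colon (C : Set S)) := by
    ext x
    rw [LinearMap.mem_ker]
    refine ⟨fun h => ⟨x.2, Ideal.Quotient.eq_zero_iff_mem.1 ?_⟩, fun h => ?_⟩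
    · have apply_one := hm x 1
      rw [h, one_mul] at apply_one
      exact apply_one.symm
    · ext
      refine (hm x 1).trans (Ideal.Quotient.eq_zero_iff_mem.2 ?_)
      rw [one_mul]
      exact h.2
  exact hker ▸ length_quotient_ker_le m

/-- Neither of the two inequalities can be strict: both sides sum to the length of `S ⧸ I`. -/
theorem IsSocleGenerator.length_quotient_colon (hu : IsSocleGenerator I u)
    (hI : Module.length S (S ⧸ I) ≠ ⊤) (C : Ideal S) :
    Module.length S (S ⧸ I.colon (C : Set S)) =
      Module.length S (C ⧸ (C ⊓ I).submoduleOf C) := by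
  have hcolon : I ≤ I.colon (C : Set S) := fun x hx =>
    Submodule.mem_colon.2 fun c _ => I.mul_mem_right c hx
  have hC := length_quotient_eq_add C I
  have hC' := length_quotient_eq_add (I.colon (C : Set S)) I
  rw [sup_eq_left.2 hcolon, add_comm] at hC'
  refine (hu.length_quotient_colon_le C).antisymm ?_
  have hfin : Module.length S (S ⧸ C ⊔ I) ≠ ⊤ := fun h => hI (by rw [hC, h, add_top])
  rw [← (ENat.addLECancellable_of_ne_top hfin).add_le_add_iff_right, ← hC, hC']
  gcongr
  exact hu.length_colon_quotient_le C

end Duality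

section RingEquiv

variable {A B : Type*} [CommRing A] [CommRing B] (ε : A ≃+* B)

theorem length_quotient_map_ringEquiv (I : Ideal A) :
    Module.length B (B ⧸ I.map ε) = Module.length A (A ⧸ I) := by
  rw [Module.length_quotient, Module.length_quotient,
    ← Order.coheight_orderIso ε.idealComapOrderIso]
  congr 1
  exact Ideal.comap_map_of_bijective ε ε.bijective

theorem apply_mem_map_ringEquiv {I : Ideal A} {x : A} : ε x ∈ I.map ε ↔ x ∈ I := by
  rw [← Ideal.mem_comap, Ideal.comap_map_of_bijective ε ε.bijective]

theorem map_colon_ringEquiv (I K : Ideal A) :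
    (I.colon (K : Set A)).map ε = (I.map ε).colon (K.map ε : Set B) := by
  ext y
  obtain ⟨x, rfl⟩ := ε.surjective y
  rw [apply_mem_map_ringEquiv, Submodule.mem_colon, Submodule.mem_colon]
  constructor
  · intro h z hz
    obtain ⟨z, rfl⟩ := ε.surjective z
    rw [smul_eq_mul, ← map_mul]
    exact (apply_mem_map_ringEquiv ε).2 (h z ((apply_mem_map_ringEquiv ε).1 hz))
  · intro h z hz
    have := h (ε z) ((apply_mem_map_ringEquiv ε).2 hz)
    rwa [smul_eq_mul, ← map_mul, apply_mem_map_ringEquiv] at this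

theorem IsSocleGenerator.map_ringEquiv {I : Ideal A} {u : A} (h : IsSocleGenerator I u) :
    IsSocleGenerator (I.map ε) (ε u) := by
  refine ⟨(apply_mem_map_ringEquiv ε).not.2 h.1, fun s hs => ?_⟩
  obtain ⟨s, rfl⟩ := ε.surjective s
  have := Ideal.mem_map_of_mem ε (h.2 s ((apply_mem_map_ringEquiv ε).not.1 hs))
  rwa [Ideal.map_sup, Ideal.map_span, Set.image_singleton] at this

end RingEquiv

/-- `F^e_* R` as an `R`-algebra: the ring `R`, regarded as an algebra over itself through the `e`-th
iterate of Frobenius. -/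
def FrobeniusAlgebra (_p _e : ℕ) (R : Type*) : Type _ := R

namespace FrobeniusAlgebra

variable (p e : ℕ) (R : Type*) [CommRing R]

instance : CommRing (FrobeniusAlgebra p e R) := inferInstanceAs (CommRing R)

/-- `F^e_* R` as a ring is `R`. -/
def ringEquiv : R ≃+* FrobeniusAlgebra p e R := RingEquiv.refl R

section Map

variable {R} {R' : Type*} [CommRing R'] (f : R →+* R')

/-- The ring homomorphism `F^e_* R → F^e_* R'` induced by `R → R'`. -/
def map : FrobeniusAlgebra p e R →+* FrobeniusAlgebra p e R' :=
  ((ringEquiv p e R').toRingHom.comp f).comp (ringEquiv p e R).symm.toRingHom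

theorem map_ringEquiv (x : R) : map p e f (ringEquiv p e R x) = ringEquiv p e R' (f x) := rfl

theorem map_surjective {f : R →+* R'} (hf : Function.Surjective f) :
    Function.Surjective (map p e f) :=
  (ringEquiv p e R').surjective.comp (hf.comp (ringEquiv p e R).symm.surjective)

theorem ker_map : RingHom.ker (map p e f) = (RingHom.ker f).map (ringEquiv p e R) := by
  ext y
  obtain ⟨x, rfl⟩ := (ringEquiv p e R).surjective y
  rw [apply_mem_map_ringEquiv, RingHom.mem_ker, map_ringEquiv,
    map_eq_zero_iff _ (ringEquiv p e R').injective, RingHom.mem_ker]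

end Map

variable [ExpChar R p]

instance : Algebra R (FrobeniusAlgebra p e R) where
  smul r x := ringEquiv p e R (r ^ p ^ e) * x
  algebraMap := (ringEquiv p e R).toRingHom.comp (iterateFrobenius R p e)
  commutes' _ _ := mul_comm _ _
  smul_def' _ _ := rfl

theorem algebraMap_eq :
    algebraMap R (FrobeniusAlgebra p e R) =
      (ringEquiv p e R).toRingHom.comp (iterateFrobenius R p e) := rfl

theorem algebraMap_apply (x : R) :
    algebraMap R (FrobeniusAlgebra p e R) x = ringEquiv p e R (x ^ p ^ e) := rfl

theorem smul_ringEquiv (r x : R) : r • ringEquiv p e R x = ringEquiv p e R (r ^ p ^ e * x) := rfl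

/-- The identification of the `R`-module `F^e_* R` with the `R`-algebra `F^e_* R`. -/
def linearEquiv : FrobeniusPushforward p e R ≃ₗ[R] FrobeniusAlgebra p e R where
  __ := (FrobeniusPushforward.of p e R).symm.trans (ringEquiv p e R).toAddEquiv
  map_smul' _ _ := rfl

instance [IsLocalRing R] : IsLocalRing (FrobeniusAlgebra p e R) :=
  (ringEquiv p e R).isLocalRing

instance [Fact p.Prime] : IsLocalHom (algebraMap R (FrobeniusAlgebra p e R)) where
  map_nonunit x hx := by
    rw [algebraMap_apply, isUnit_map_iff] at hx
    exact (isUnit_pow_iff (pow_ne_zero _ (Fact.out : p.Prime).ne_zero)).1 hx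

theorem map_algebraMap {R' : Type*} [CommRing R'] [ExpChar R' p] (f : R →+* R') (x : R) :
    map p e f (algebraMap R (FrobeniusAlgebra p e R) x) =
      algebraMap R' (FrobeniusAlgebra p e R') (f x) := by
  rw [algebraMap_apply, algebraMap_apply, map_ringEquiv, map_pow]

/-- `F^{e+1}_* R` as an algebra over `F^e_* R`, through the Frobenius. -/
abbrev algebraSucc : Algebra (FrobeniusAlgebra p e R) (FrobeniusAlgebra p (e + 1) R) :=
  (((ringEquiv p (e + 1) R).toRingHom.comp (frobenius R p)).comp
    (ringEquiv p e R).symm.toRingHom).toAlgebra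

attribute [local instance] algebraSucc in
theorem isScalarTower_succ :
    IsScalarTower R (FrobeniusAlgebra p e R) (FrobeniusAlgebra p (e + 1) R) :=
  .of_algebraMap_eq fun x => by
    change ringEquiv p (e + 1) R (x ^ p ^ (e + 1)) = ringEquiv p (e + 1) R ((x ^ p ^ e) ^ p)
    rw [← pow_mul, pow_succ]

attribute [local instance] algebraSucc in
theorem algebraMap_succ_comp_ringEquiv :
    (algebraMap (FrobeniusAlgebra p e R) (FrobeniusAlgebra p (e + 1) R)).comp
        (ringEquiv p e R).toRingHom =
      ((ringEquiv p 1 R).symm.trans (ringEquiv p (e + 1) R)).toRingHom.comp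
        (algebraMap R (FrobeniusAlgebra p 1 R)) := by
  ext x
  change ringEquiv p (e + 1) R (x ^ p) = ringEquiv p (e + 1) R (x ^ p ^ 1)
  rw [pow_one]

attribute [local instance] algebraSucc in
theorem finite_of_isFFinite (h : IsFFinite p R) : Module.Finite R (FrobeniusAlgebra p e R) := by
  induction e with
  | zero =>
    refine Module.Finite.of_surjective (Algebra.linearMap R (FrobeniusAlgebra p 0 R)) fun x => ?_
    refine ⟨(ringEquiv p 0 R).symm x, ?_⟩
    rw [Algebra.linearMap_apply, algebraMap_apply]
    simp
  | succ e ih =>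
    have : Module.Finite R (FrobeniusPushforward p 1 R) := h
    have := Module.Finite.equiv (linearEquiv p 1 R)
    have := isScalarTower_succ p e R
    have : Module.Finite (FrobeniusAlgebra p e R) (FrobeniusAlgebra p (e + 1) R) :=
      Module.Finite.of_equiv_equiv (ringEquiv p e R)
        ((ringEquiv p 1 R).symm.trans (ringEquiv p (e + 1) R))
        (algebraMap_succ_comp_ringEquiv p e R)
    exact Module.Finite.trans (FrobeniusAlgebra p e R) _

end FrobeniusAlgebra

section ResidueDegree

open FrobeniusAlgebra

variable (p e : ℕ) [Fact p.Prime]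

instance (k : Type*) [Field k] : Field (FrobeniusAlgebra p e k) := inferInstanceAs (Field k)

attribute [local instance] algebraSucc in
theorem finrank_frobeniusAlgebra_field (k : Type*) [Field k] [CharP k p] :
    Module.finrank k (FrobeniusAlgebra p e k) =
      Module.finrank (frobenius k p).fieldRange k ^ e := by
  have finrank_one : Module.finrank k (FrobeniusAlgebra p 1 k) =
      Module.finrank (frobenius k p).fieldRange k := by
    refine Algebra.finrank_eq_of_equiv_equiv (RingEquiv.ofBijective
      (frobenius k p).rangeRestrictField (frobenius k p).rangeRestrictField_bijective)
      (ringEquiv p 1 k).symm ?_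
    ext x
    change x ^ p = x ^ p ^ 1
    rw [pow_one]
  induction e with
  | zero =>
    rw [pow_zero, ← Module.finrank_self k]
    refine (Algebra.finrank_eq_of_equiv_equiv (RingEquiv.refl k) (ringEquiv p 0 k) ?_).symm
    ext x
    change ringEquiv p 0 k (x ^ p ^ 0) = ringEquiv p 0 k x
    rw [pow_zero, pow_one]
  | succ e ih =>
    have := isScalarTower_succ p e k
    rw [← Module.finrank_mul_finrank k (FrobeniusAlgebra p e k)
      (FrobeniusAlgebra p (e + 1) k), ih, pow_succ, ← finrank_one]
    congr 1
    exact (Algebra.finrank_eq_of_equiv_equiv (ringEquiv p e k)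
      ((ringEquiv p 1 k).symm.trans (ringEquiv p (e + 1) k))
      (algebraMap_succ_comp_ringEquiv p e k)).symm

variable (R : Type*) [CommRing R] [IsLocalRing R] [CharP R p]

/-- The degree `[k : k ^ p]` for the residue field `k`. -/
noncomputable abbrev residueFrobeniusDegree : ℕ :=
  Module.finrank (frobenius (ResidueField R) p).fieldRange (ResidueField R)

theorem finrank_residueField_frobeniusAlgebra :
    Module.finrank (ResidueField R) (ResidueField (FrobeniusAlgebra p e R)) =
      residueFrobeniusDegree p R ^ e := by
  rw [← finrank_frobeniusAlgebra_field]
  refine Algebra.finrank_eq_of_equiv_equiv (RingEquiv.refl _)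
    ((ResidueField.mapEquiv (ringEquiv p e R)).symm.trans (ringEquiv p e (ResidueField R))) ?_
  ext x
  obtain ⟨y, rfl⟩ := residue_surjective x
  simp only [RingHom.comp_apply, RingEquiv.toRingHom_eq_coe, RingHom.coe_coe, RingEquiv.trans_apply,
    RingEquiv.refl_apply, ResidueField.algebraMap_residue, FrobeniusAlgebra.algebraMap_apply,
    ResidueField.mapEquiv.symm, ResidueField.mapEquiv_apply, ResidueField.map_residue, map_pow]
  simp

theorem finite_residueField (h : IsFFinite p R) :
    Module.Finite (ResidueField R) (ResidueField (FrobeniusAlgebra p e R)) := by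
  have := finite_of_isFFinite p e R h
  infer_instance

theorem residueFrobeniusDegree_pos (h : IsFFinite p R) : 0 < residueFrobeniusDegree p R := by
  have := finite_residueField p 1 R h
  rw [← pow_one (residueFrobeniusDegree p R), ← finrank_residueField_frobeniusAlgebra]
  exact Module.finrank_pos

theorem length_frobeniusAlgebra (h : IsFFinite p R) (M : Type*) [AddCommGroup M] [Module R M]
    [Module (FrobeniusAlgebra p e R) M] [IsScalarTower R (FrobeniusAlgebra p e R) M] :
    Module.length R M =
      Module.length (FrobeniusAlgebra p e R) M * (residueFrobeniusDegree p R ^ e : ℕ) := by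
  have := finite_residueField p e R h
  rw [length_restrictScalars R (FrobeniusAlgebra p e R) M, Module.length_eq_finrank,
    finrank_residueField_frobeniusAlgebra]

end ResidueDegree

section SplittingNumber

open FrobeniusAlgebra

theorem fSplittingNumber_eq_sSup (p e : ℕ) (R : Type*) [CommRing R] [ExpChar R p] :
    fSplittingNumber p e R = sSup (freeSummandRanks R (FrobeniusAlgebra p e R)) := by
  refine congrArg sSup (Set.ext fun a => ?_)
  exact ⟨fun ⟨N, h1, h2, ⟨f⟩⟩ => ⟨N, h1, h2, ⟨(linearEquiv p e R).symm ≪≫ₗ f⟩⟩,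
    fun ⟨N, h1, h2, ⟨f⟩⟩ => ⟨N, h1, h2, ⟨linearEquiv p e R ≪≫ₗ f⟩⟩⟩

theorem map_algebraMap_frobeniusAlgebra (p e : ℕ) (R : Type*) [CommRing R] [ExpChar R p]
    (I : Ideal R) :
    I.map (algebraMap R (FrobeniusAlgebra p e R)) =
      (frobeniusPower p e I).map (ringEquiv p e R) := by
  rw [algebraMap_eq, ← Ideal.map_map]
  rfl

variable (p e : ℕ) [Fact p.Prime] (R : Type*) [CommRing R] [IsLocalRing R] [CharP R p]

theorem length_quotient_frobeniusAlgebra (h : IsFFinite p R) (I : Ideal R) :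
    Module.length R (FrobeniusAlgebra p e R ⧸ I.map (ringEquiv p e R)) =
      Module.length R (R ⧸ I) * (residueFrobeniusDegree p R ^ e : ℕ) := by
  rw [length_frobeniusAlgebra p e R h, length_quotient_map_ringEquiv]

/-- The ideal of the elements `x` for which `F^e_* x` does not generate a free summand. -/
noncomputable def nonsplittingIdeal : Ideal R :=
  (algebraNonsplittingIdeal R (FrobeniusAlgebra p e R)).comap (ringEquiv p e R)

theorem fSplittingNumber_eq_length (h : IsFFinite p R) :
    (fSplittingNumber p e R : ℕ∞) =
      Module.length R (R ⧸ nonsplittingIdeal p e R) * (residueFrobeniusDegree p R ^ e : ℕ) := by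
  have := finite_of_isFFinite p e R h
  rw [fSplittingNumber_eq_sSup, ← length_quotient_algebraNonsplittingIdeal,
    ← length_quotient_frobeniusAlgebra p e R h, nonsplittingIdeal,
    Ideal.map_comap_of_surjective _ (ringEquiv p e R).surjective]

theorem length_quotient_nonsplittingIdeal_ne_top (h : IsFFinite p R) :
    Module.length R (R ⧸ nonsplittingIdeal p e R) ≠ ⊤ := by
  intro htop
  have := fSplittingNumber_eq_length p e R h
  rw [htop, ENat.top_mul (by
    exact_mod_cast (pow_pos (residueFrobeniusDegree_pos p R h) e).ne')] at this
  exact ENat.natCast_ne_top _ this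

end SplittingNumber

section Regular

open FrobeniusAlgebra RingTheory.Sequence

variable (p e : ℕ) [Fact p.Prime] (S : Type*) [CommRing S] [IsRegularLocalRing S] [CharP S p]

theorem free_frobeniusAlgebra (h : IsFFinite p S) : Module.Free S (FrobeniusAlgebra p e S) := by
  have := finite_of_isFFinite p e S h
  obtain ⟨L, hLm, hL⟩ := exists_regularParameters_isSocleGenerator_pow S
  refine free_of_isWeaklyRegular_of_ofList_eq_maximalIdeal _ S _ L rfl hLm ?_
  rw [← isWeaklyRegular_map_algebraMap_iff (R := S) (FrobeniusAlgebra p e S)]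
  have powers_regular := (hL (p ^ e) (pow_ne_zero _ (Fact.out : p.Prime).ne_zero)).1
  refine (AddEquiv.isWeaklyRegular_congr (e := (ringEquiv p e S).toAddEquiv) ?_).1 powers_regular
  rw [List.forall₂_map_left_iff, List.forall₂_map_right_iff, List.forall₂_same]
  exact fun x _ y => map_mul (ringEquiv p e S) _ _

theorem exists_isSocleGenerator_frobeniusPower :
    ∃ u, IsSocleGenerator (frobeniusPower p e (maximalIdeal S)) u := by
  obtain ⟨L, hLm, hL⟩ := exists_regularParameters_isSocleGenerator_pow S
  rw [frobeniusPower, ← hLm, Ideal.map_ofList]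
  exact (hL (p ^ e) (pow_ne_zero _ (Fact.out : p.Prime).ne_zero)).2

theorem exists_isDualGenerator_frobeniusAlgebra (h : IsFFinite p S) :
    ∃ T : FrobeniusAlgebra p e S →ₗ[S] S, IsDualGenerator T := by
  have := finite_of_isFFinite p e S h
  have := free_frobeniusAlgebra p e S h
  obtain ⟨u, hu⟩ := exists_isSocleGenerator_frobeniusPower p e S
  have hu' := hu.map_ringEquiv (ringEquiv p e S)
  rw [← map_algebraMap_frobeniusAlgebra] at hu'
  exact hu'.exists_isDualGenerator

theorem map_fedderIdeal (J : Ideal S) : (fedderIdeal p e J).map (ringEquiv p e S) =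
    ((maximalIdeal S).map (algebraMap S (FrobeniusAlgebra p e S))).colon
      ((J.map (algebraMap S (FrobeniusAlgebra p e S))).colon
        (J.map (ringEquiv p e S) : Set (FrobeniusAlgebra p e S)) :
          Set (FrobeniusAlgebra p e S)) := by
  rw [fedderIdeal, frobeniusColon, map_colon_ringEquiv, map_colon_ringEquiv,
    map_algebraMap_frobeniusAlgebra, map_algebraMap_frobeniusAlgebra]

theorem comap_nonsplittingIdeal (h : IsFFinite p S) {R : Type*} [CommRing R] [IsLocalRing R]
    [CharP R p] {ρ : S →+* R} (hρ : Function.Surjective ρ) :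
    (nonsplittingIdeal p e R).comap ρ = fedderIdeal p e (RingHom.ker ρ) := by
  have := finite_of_isFFinite p e S h
  have := free_frobeniusAlgebra p e S h
  obtain ⟨T, hT⟩ := exists_isDualGenerator_frobeniusAlgebra p e S h
  have pullback :=
    comap_algebraNonsplittingIdeal hT hρ (map_surjective p e hρ) (map_algebraMap p e S ρ)
  rw [ker_map, ← map_fedderIdeal] at pullback
  ext x
  rw [← apply_mem_map_ringEquiv (ringEquiv p e S) (I := fedderIdeal p e _),
    ← pullback]
  rfl

theorem length_quotient_fedderIdeal (h : IsFFinite p S) (J : Ideal S) [Nontrivial (S ⧸ J)] :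
    Module.length S (S ⧸ fedderIdeal p e J) =
      Module.length (S ⧸ J) ((S ⧸ J) ⧸ nonsplittingIdeal p e (S ⧸ J)) := by
  rw [← Module.length_eq_of_surjective (S := S) (R := S ⧸ J) Ideal.Quotient.mk_surjective]
  let f : S →ₗ[S] (S ⧸ J) ⧸ nonsplittingIdeal p e (S ⧸ J) :=
    ((nonsplittingIdeal p e (S ⧸ J)).mkQ.restrictScalars S) ∘ₗ J.mkQ
  have hf : Function.Surjective f :=
    (Submodule.mkQ_surjective _).comp (Submodule.mkQ_surjective _)
  have hker : LinearMap.ker f = fedderIdeal p e J := by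
    have hcomap := comap_nonsplittingIdeal p e S h (Ideal.Quotient.mk_surjective (I := J))
    rw [J.mk_ker] at hcomap
    rw [← hcomap]
    ext x
    exact Submodule.Quotient.mk_eq_zero _
  rw [← hker, (f.quotKerEquivOfSurjective hf).length_eq]

end Regular

section LengthBounds

variable {R : Type*} [CommRing R]

theorem length_quotient_anti {I K : Ideal R} (h : I ≤ K) :
    Module.length R (R ⧸ K) ≤ Module.length R (R ⧸ I) :=
  Module.length_le_of_surjective (Submodule.factor h) (Submodule.factor_surjective h)

theorem length_quotient_sup_span_mul_le (I : Ideal R) (x y : R) :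
    Module.length R (R ⧸ I ⊔ Ideal.span {x * y}) ≤
      Module.length R (R ⧸ I ⊔ Ideal.span {y}) + Module.length R (R ⧸ I ⊔ Ideal.span {x}) := by
  have hle : I ⊔ Ideal.span {y} ≤
      Submodule.comap (LinearMap.mulLeft R x) (I ⊔ Ideal.span {x * y}) := by
    rw [← Submodule.map_le_iff_le_comap, Submodule.map_sup, Ideal.span, Submodule.map_span,
      Set.image_singleton]
    refine sup_le_sup (Submodule.map_le_iff_le_comap.2 fun z hz => ?_) le_rfl
    exact I.mul_mem_left x hz
  refine length_le_add_of_exact (f := Submodule.mapQ _ _ (LinearMap.mulLeft R x) hle)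
    (g := Submodule.factor (sup_le_sup_left (Ideal.span_singleton_le_span_singleton.2
      (Dvd.intro y rfl)) I)) fun z => ?_
  obtain ⟨z, rfl⟩ := Submodule.Quotient.mk_surjective _ z
  constructor
  · intro hz
    obtain ⟨t, ht⟩ := mem_sup_span_singleton_iff.1 ((Submodule.Quotient.mk_eq_zero _).1 hz)
    refine ⟨Submodule.Quotient.mk t, (Submodule.Quotient.eq _).2 (Ideal.mem_sup_left ?_)⟩
    rw [LinearMap.mulLeft_apply, mul_comm, ← neg_sub]
    exact I.neg_mem ht
  · rintro ⟨t, ht⟩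
    obtain ⟨t, rfl⟩ := Submodule.Quotient.mk_surjective _ t
    rw [← ht]
    exact (Submodule.Quotient.mk_eq_zero _).2 (Ideal.mem_sup_right
      (Ideal.mul_mem_right _ _ (Ideal.mem_span_singleton_self _)))

theorem length_quotient_sup_span_pow_le (I : Ideal R) (x : R) (a : ℕ) :
    Module.length R (R ⧸ I ⊔ Ideal.span {x ^ a}) ≤
      a * Module.length R (R ⧸ I ⊔ Ideal.span {x}) := by
  induction a with
  | zero =>
    have : I ⊔ Ideal.span {x ^ 0} = ⊤ := by simp
    rw [this]
    simp [Module.length_eq_zero]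
  | succ a ih =>
    rw [pow_succ]
    refine (length_quotient_sup_span_mul_le I _ x).trans ?_
    rw [Nat.cast_succ, add_one_mul, add_comm]
    gcongr

theorem length_quotient_sup_ofList_pow_le (q : ℕ) (L : List R) : ∀ I : Ideal R,
    Module.length R (R ⧸ I ⊔ Ideal.ofList (L.map (· ^ q))) ≤
      (q ^ L.length : ℕ) * Module.length R (R ⧸ I ⊔ Ideal.ofList L) := by
  induction L with
  | nil =>
    intro I
    rw [List.map_nil, List.length_nil, pow_zero, Nat.cast_one, one_mul]
  | cons x L ih =>
    intro I
    rw [List.map_cons, Ideal.ofList_cons, ← sup_assoc, Ideal.ofList_cons]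
    refine (ih _).trans ?_
    rw [sup_right_comm, List.length_cons, pow_succ, Nat.cast_mul, mul_assoc, ← sup_assoc,
      sup_right_comm I (Ideal.span {x})]
    gcongr
    exact length_quotient_sup_span_pow_le _ x q

variable {M : Type*} [AddCommGroup M] [Module R M] {I : Ideal R}

theorem length_span_range_le (hI : I ≤ Module.annihilator R M) {n : ℕ} (w : Fin n → M) :
    Module.length R (Submodule.span R (Set.range w)) ≤ n * Module.length R (R ⧸ I) := by
  let f : (Fin n → R ⧸ I) →ₗ[R] M := ∑ i, (Submodule.liftQ I (LinearMap.toSpanSingleton R M (w i))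
    (fun a ha => Module.mem_annihilator.1 (hI ha) _)) ∘ₗ LinearMap.proj i
  have hle : Submodule.span R (Set.range w) ≤ LinearMap.range f := by
    rw [Submodule.span_le]
    rintro _ ⟨i, rfl⟩
    refine ⟨Pi.single i (Submodule.Quotient.mk 1), ?_⟩
    simp only [f, LinearMap.sum_apply, LinearMap.comp_apply, LinearMap.proj_apply]
    rw [Finset.sum_eq_single i]
    · rw [Pi.single_eq_same]
      exact one_smul R (w i)
    · intro j _ hj
      rw [Pi.single_eq_of_ne hj, map_zero]
    · simp
  calc Module.length R (Submodule.span R (Set.range w))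
      ≤ Module.length R (LinearMap.range f) :=
        Module.length_le_of_injective (Submodule.inclusion hle) (Submodule.inclusion_injective hle)
    _ ≤ Module.length R (Fin n → R ⧸ I) :=
        Module.length_le_of_surjective f.rangeRestrict f.surjective_rangeRestrict
    _ = n * Module.length R (R ⧸ I) := by rw [Module.length_pi_of_fintype]; simp

theorem length_le_of_smul_mem_span (hI : I ≤ Module.annihilator R M) {r n : ℕ} {v : Fin r → M}
    {w : Fin n → M} (hw : Submodule.span R (Set.range w) = ⊤) {c : R}
    (hc : ∀ x, c • x ∈ Submodule.span R (Set.range v)) :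
    Module.length R M ≤ r * Module.length R (R ⧸ I) +
      n * Module.length R (R ⧸ I ⊔ Ideal.span {c}) := by
  set N := Submodule.span R (Set.range v)
  have hN : I ⊔ Ideal.span {c} ≤ Module.annihilator R (M ⧸ N) := by
    refine sup_le (fun a ha => ?_) ((Ideal.span_singleton_le_iff_mem _).2 ?_) <;>
      refine Module.mem_annihilator.2 fun x => ?_ <;>
      obtain ⟨x, rfl⟩ := Submodule.Quotient.mk_surjective _ x <;>
      rw [← Submodule.Quotient.mk_smul]
    · rw [Module.mem_annihilator.1 (hI ha), Submodule.Quotient.mk_zero]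
    · exact (Submodule.Quotient.mk_eq_zero _).2 (hc x)
  have hspan : Submodule.span R (Set.range (N.mkQ ∘ w)) = ⊤ := by
    rw [Set.range_comp, ← Submodule.map_span, hw, Submodule.map_top, Submodule.range_mkQ]
  have hquot := length_span_range_le hN (N.mkQ ∘ w)
  rw [hspan, Module.length_top] at hquot
  rw [Module.length_eq_add_of_exact N.subtype N.mkQ N.subtype_injective N.mkQ_surjective
    (LinearMap.exact_subtype_mkQ N)]
  exact add_le_add (length_span_range_le hI v) hquot

theorem length_quotient_smul_top_le {r n : ℕ} {v : Fin r → M} {w : Fin n → M}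
    (hw : Submodule.span R (Set.range w) = ⊤) {c : R}
    (hc : ∀ x, c • x ∈ Submodule.span R (Set.range v)) (I : Ideal R) :
    Module.length R (M ⧸ (I • ⊤ : Submodule R M)) ≤ r * Module.length R (R ⧸ I) +
      n * Module.length R (R ⧸ I ⊔ Ideal.span {c}) := by
  set K : Submodule R M := I • ⊤
  have hI : I ≤ Module.annihilator R (M ⧸ K) := fun a ha => Module.mem_annihilator.2 fun x => by
    obtain ⟨x, rfl⟩ := Submodule.Quotient.mk_surjective _ x
    exact (Submodule.Quotient.mk_eq_zero _).2 (Submodule.smul_mem_smul ha trivial)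
  refine length_le_of_smul_mem_span hI (v := K.mkQ ∘ v) (w := K.mkQ ∘ w) ?_ fun x => ?_
  · rw [Set.range_comp, ← Submodule.map_span, hw, Submodule.map_top, Submodule.range_mkQ]
  · obtain ⟨x, rfl⟩ := Submodule.Quotient.mk_surjective _ x
    rw [Set.range_comp, ← Submodule.map_span]
    exact Submodule.mem_map_of_mem (f := K.mkQ) (hc x)

theorem card_le_length_quotient_maximalIdeal_smul_top [IsLocalRing R] [Module.Finite R M]
    {ι : Type*} [Fintype ι] {v : ι → M} (hv : LinearIndependent R v) :
    (Fintype.card ι : ℕ∞) ≤ Module.length R (M ⧸ (maximalIdeal R • ⊤ : Submodule R M)) := by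
  have hfg : (⊤ : Submodule R M).FG := Module.Finite.fg_top
  obtain ⟨s, hs, hspan⟩ := Submodule.FG.exists_span_finset_card_eq_spanFinrank hfg
  have hcard := linearIndependent_le_span v hv s hspan
  simp only [Cardinal.mk_fintype, Nat.cast_le, Finset.coe_sort_coe, Fintype.card_coe] at hcard
  rw [hs, IsLocalRing.spanFinrank_eq_finrank_quotient _ hfg] at hcard
  refine (Nat.cast_le.2 hcard).trans ?_
  let := Ideal.Quotient.field (maximalIdeal R)
  have := Module.Finite.of_restrictScalars_finite R (R ⧸ maximalIdeal R)
    ((⊤ : Submodule R M) ⧸ maximalIdeal R • (⊤ : Submodule R (⊤ : Submodule R M)))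
  rw [← Module.length_eq_finrank, ← Module.length_eq_of_surjective (S := R)
    Ideal.Quotient.mk_surjective]
  refine le_of_eq (LinearEquiv.length_eq (Submodule.Quotient.equiv _ _ Submodule.topEquiv ?_))
  rw [Submodule.map_smul'']
  simp

end LengthBounds

section ParameterBound

theorem maximalIdeal_mem_minimalPrimes_of_map_mk {R : Type*} [CommRing R] [IsLocalRing R]
    {I K : Ideal R} [Nontrivial (R ⧸ I)]
    (hK : maximalIdeal (R ⧸ I) ∈ (K.map (Ideal.Quotient.mk I)).minimalPrimes) :
    maximalIdeal R ∈ (I ⊔ K).minimalPrimes := by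
  have h := Ideal.minimalPrimes_comap_of_surjective Ideal.Quotient.mk_surjective hK
  rwa [comap_mk_maximalIdeal, Ideal.comap_map_of_surjective _ Ideal.Quotient.mk_surjective,
    ← RingHom.ker_eq_comap_bot, Ideal.mk_ker, sup_comm] at h

theorem exists_list_length_quotient_ne_top {R : Type*} [CommRing R]
    [IsLocalRing R] [IsNoetherianRing R] (I : Ideal R) [Nontrivial (R ⧸ I)] {t : ℕ}
    (ht : ringKrullDim (R ⧸ I) ≤ t) : ∃ L : List R, L.length ≤ t ∧
      (∀ x ∈ L, x ∈ maximalIdeal R) ∧ Module.length R (R ⧸ I ⊔ Ideal.ofList L) ≠ ⊤ := by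
  obtain ⟨s, hs, hcard⟩ :=
    (maximalIdeal (R ⧸ I)).exists_finset_card_eq_height_of_isNoetherianRing
  obtain ⟨L, hL⟩ := List.map_surjective_iff.2 (Ideal.Quotient.mk_surjective (I := I)) s.toList
  have hspan : Ideal.span (s : Set (R ⧸ I)) = (Ideal.ofList L).map (Ideal.Quotient.mk I) := by
    rw [Ideal.map_ofList, hL, Ideal.ofList]
    congr 1
    ext; simp
  rw [hspan] at hs
  have hmin := maximalIdeal_mem_minimalPrimes_of_map_mk hs
  refine ⟨L, ?_, fun x hx => hmin.1.2 (Ideal.mem_sup_right (Ideal.subset_span hx)), ?_⟩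
  · rw [← maximalIdeal_height_eq_ringKrullDim, ← hcard] at ht
    have hs_card : s.card ≤ t := by exact_mod_cast ht
    rwa [← Finset.length_toList, ← hL, List.length_map] at hs_card
  · have := IsLocalRing.quotient_artinian_of_mem_minimalPrimes_of_isLocalRing _ hmin
    rw [Module.length_eq_of_surjective (R := R ⧸ I ⊔ Ideal.ofList L) Ideal.Quotient.mk_surjective]
    exact Module.length_ne_top

theorem exists_length_quotient_sup_frobeniusPower_le (p : ℕ) [Fact p.Prime] {R : Type*}
    [CommRing R] [IsLocalRing R] [IsNoetherianRing R] [CharP R p] (I : Ideal R) {t : ℕ}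
    (ht : ringKrullDim (R ⧸ I) ≤ t) : ∃ C : ℕ, ∀ e : ℕ,
      Module.length R (R ⧸ I ⊔ frobeniusPower p e (maximalIdeal R)) ≤ (C * (p ^ e) ^ t : ℕ) := by
  rcases subsingleton_or_nontrivial (R ⧸ I) with h | h
  · refine ⟨0, fun e => ?_⟩
    rw [Ideal.Quotient.subsingleton_iff.1 h, top_sup_eq]
    simp [Module.length_eq_zero]
  obtain ⟨L, hLt, hLm, hfin⟩ := exists_list_length_quotient_ne_top I ht
  obtain ⟨C, hC⟩ := ENat.ne_top_iff_exists.1 hfin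
  refine ⟨C, fun e => ?_⟩
  have hle : I ⊔ Ideal.ofList (L.map (· ^ p ^ e)) ≤ I ⊔ frobeniusPower p e (maximalIdeal R) := by
    refine sup_le_sup_left (Ideal.span_le.2 fun y hy => ?_) I
    obtain ⟨x, hx, rfl⟩ := List.mem_map.1 hy
    exact Ideal.mem_map_of_mem (iterateFrobenius R p e) (hLm x hx)
  refine (length_quotient_anti hle).trans
    ((length_quotient_sup_ofList_pow_le _ _ _).trans ?_)
  rw [← hC, mul_comm C]
  exact_mod_cast Nat.mul_le_mul_right C
    (Nat.pow_le_pow_right (pow_pos (Fact.out : p.Prime).pos e) hLt)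

theorem length_quotient_frobeniusPower_maximalIdeal_ne_top (p e : ℕ) [Fact p.Prime] (R : Type*)
    [CommRing R] [IsLocalRing R] [IsNoetherianRing R] [CharP R p] :
    Module.length R (R ⧸ frobeniusPower p e (maximalIdeal R)) ≠ ⊤ := by
  have hmin : maximalIdeal R ∈ (frobeniusPower p e (maximalIdeal R)).minimalPrimes := by
    refine ⟨⟨inferInstance, Ideal.map_le_iff_le_comap.2 fun x hx => ?_⟩, fun P hP _ x hx => ?_⟩
    · exact Ideal.pow_mem_of_mem _ hx _ (pow_pos (Fact.out : p.Prime).pos e)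
    · exact hP.1.mem_of_pow_mem _ (hP.2 (Ideal.mem_map_of_mem (iterateFrobenius R p e) hx))
  have := IsLocalRing.quotient_artinian_of_mem_minimalPrimes_of_isLocalRing _ hmin
  rw [Module.length_eq_of_surjective (R := R ⧸ frobeniusPower p e (maximalIdeal R))
    Ideal.Quotient.mk_surjective]
  exact Module.length_ne_top

theorem length_fedderQuotient (p e : ℕ) [Fact p.Prime] {S : Type*} [CommRing S]
    [IsRegularLocalRing S] [CharP S p] (J : Ideal S) :
    Module.length S (S ⧸ fedderIdeal p e J) = Module.length S (FedderQuotient p e J) := by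
  obtain ⟨u, hu⟩ := exists_isSocleGenerator_frobeniusPower p e S
  exact hu.length_quotient_colon (length_quotient_frobeniusPower_maximalIdeal_ne_top p e S)
    (frobeniusColon p e J)

end ParameterBound

section NonsplittingIdeal

open FrobeniusAlgebra

variable (p e : ℕ)

/-- The `p`-th power map `F^e_* R → F^{e+1}_* R`, which is linear over `R`. -/
def FrobeniusAlgebra.powMap (R : Type*) [CommRing R] [ExpChar R p] :
    FrobeniusAlgebra p e R →ₗ[R] FrobeniusAlgebra p (e + 1) R where
  toFun x := ringEquiv p (e + 1) R ((ringEquiv p e R).symm x ^ p)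
  map_add' x y := by rw [map_add, add_pow_expChar, map_add]
  map_smul' r x := by
    obtain ⟨x, rfl⟩ := (ringEquiv p e R).surjective x
    rw [smul_ringEquiv, RingHom.id_apply, RingEquiv.symm_apply_apply, RingEquiv.symm_apply_apply,
      smul_ringEquiv, mul_pow, ← pow_mul, pow_succ]

variable [Fact p.Prime] {R : Type*} [CommRing R] [IsLocalRing R] [CharP R p]

theorem mem_nonsplittingIdeal {x : R} : x ∈ nonsplittingIdeal p e R ↔
    ∀ φ : FrobeniusAlgebra p e R →ₗ[R] R, φ (ringEquiv p e R x) ∈ maximalIdeal R := Iff.rfl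

theorem mem_nonsplittingIdeal_of_smul_eq_zero {b c : R} (hb : b ≠ 0)
    (h : b • ringEquiv p e R c = 0) : c ∈ nonsplittingIdeal p e R := by
  refine (mem_nonsplittingIdeal p e).2 fun φ => by_contra fun hφ => hb ?_
  have : b * φ (ringEquiv p e R c) = 0 := by rw [← smul_eq_mul, ← map_smul, h, map_zero]
  exact (notMem_maximalIdeal.1 hφ).mul_left_eq_zero.1 this

theorem mem_nonsplittingIdeal_of_mul_eq_zero {b c : R} (hb : b ≠ 0) (h : b * c = 0) :
    c ∈ nonsplittingIdeal p e R := by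
  refine mem_nonsplittingIdeal_of_smul_eq_zero p e hb ?_
  obtain ⟨q, hq⟩ := Nat.exists_eq_succ_of_ne_zero (pow_ne_zero e (Fact.out : p.Prime).ne_zero)
  rw [smul_ringEquiv, hq, pow_succ, mul_assoc, h, mul_zero, map_zero]

theorem nonsplittingIdeal_eq_top_of_not_isReduced (h : ¬ IsReduced R) (he : e ≠ 0) :
    nonsplittingIdeal p e R = ⊤ := by
  obtain ⟨b, hb, hb0⟩ : ∃ b : R, b ^ 2 = 0 ∧ b ≠ 0 := by
    by_contra! hcon
    exact h ((isReduced_iff_pow_one_lt 2 one_lt_two).2 hcon)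
  have : 2 ≤ p ^ e := (Fact.out : p.Prime).two_le.trans (Nat.le_self_pow he p)
  refine (Ideal.eq_top_iff_one _).2 (mem_nonsplittingIdeal_of_smul_eq_zero p e hb0 ?_)
  rw [smul_ringEquiv, pow_eq_zero_of_le this hb, zero_mul, map_zero]

variable (R)

theorem frobeniusPower_maximalIdeal_le_nonsplittingIdeal :
    frobeniusPower p e (maximalIdeal R) ≤ nonsplittingIdeal p e R := by
  refine Ideal.map_le_iff_le_comap.2 fun r hr => (mem_nonsplittingIdeal p e).2 fun φ => ?_
  have : r • ringEquiv p e R 1 = ringEquiv p e R (r ^ p ^ e) := by rw [smul_ringEquiv, mul_one]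
  change φ (ringEquiv p e R (r ^ p ^ e)) ∈ maximalIdeal R
  rw [← this, map_smul]
  exact Ideal.mul_mem_right _ _ hr

theorem frobeniusPower_nonsplittingIdeal_le :
    frobeniusPower p 1 (nonsplittingIdeal p e R) ≤ nonsplittingIdeal p (e + 1) R := by
  refine Ideal.map_le_iff_le_comap.2 fun x hx => (mem_nonsplittingIdeal p (e + 1)).2 fun φ => ?_
  change φ (ringEquiv p (e + 1) R (x ^ p ^ 1)) ∈ maximalIdeal R
  rw [pow_one]
  exact hx (φ ∘ₗ powMap p e R)

end NonsplittingIdeal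

section Sequences

theorem tendsto_of_le_add_geometric {u : ℕ → ℝ} (h0 : ∀ e, 0 ≤ u e) {C p : ℝ} (hp : 1 < p)
    (hC : 0 ≤ C) (h : ∀ e, u (e + 1) ≤ u e + C / p ^ e) :
    ∃ s, Tendsto u atTop (𝓝 s) := by
  have hp1 : 0 < p - 1 := sub_pos.2 hp
  set K := p * C / (p - 1) with hK
  have K_sub : K - K / p = C := by
    rw [hK]
    field_simp
  have anti : Antitone fun e => u e + K / p ^ e := antitone_nat_of_succ_le fun e => by
    have : K / p ^ (e + 1) + C / p ^ e = K / p ^ e := by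
      rw [← K_sub, pow_succ]
      field_simp
      ring
    linarith [h e]
  have bddBelow : BddBelow (Set.range fun e => u e + K / p ^ e) := ⟨0, by
    rintro _ ⟨e, rfl⟩
    have := h0 e
    positivity⟩
  have correction : Tendsto (fun e : ℕ => K / p ^ e) atTop (𝓝 0) :=
    tendsto_const_nhds.div_atTop (tendsto_pow_atTop_atTop_of_one_lt hp)
  exact ⟨_, by simpa using (tendsto_atTop_ciInf anti bddBelow).sub correction⟩

theorem le_of_pow_le_mul_pow {r K C : ℕ} (hK : 0 < K) (h : ∀ e : ℕ, r ^ e ≤ C * K ^ e) :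
    r ≤ K := by
  by_contra! hlt
  have one_lt : (1 : ℝ) < (r : ℝ) / K := by
    rw [one_lt_div (by positivity)]
    exact_mod_cast hlt
  obtain ⟨e, he⟩ := pow_unbounded_of_one_lt (C : ℝ) one_lt
  rw [div_pow, lt_div_iff₀ (by positivity)] at he
  exact absurd (h e) (not_le.2 (by exact_mod_cast he))

end Sequences

section SplittingLength

variable (p : ℕ) [Fact p.Prime] (R : Type*) [CommRing R] [IsLocalRing R] [CharP R p]

/-- The length of `R / I_e`, where `I_e` is the nonsplitting ideal; for `F`-finite `R` it is
finite, so that `toNat` loses nothing. -/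
noncomputable def splittingLength (e : ℕ) : ℕ :=
  (Module.length R (R ⧸ nonsplittingIdeal p e R)).toNat

variable {R}

theorem coe_splittingLength (h : IsFFinite p R) (e : ℕ) :
    (splittingLength p R e : ℕ∞) = Module.length R (R ⧸ nonsplittingIdeal p e R) :=
  ENat.natCast_toNat (length_quotient_nonsplittingIdeal_ne_top p e R h)

theorem exists_length_quotient_sup_frobeniusPower_mul_le [IsNoetherianRing R] (I : Ideal R) {d : ℕ}
    (hd : ringKrullDim (R ⧸ I) + 1 ≤ d) : ∃ C : ℕ, ∀ e : ℕ,
      Module.length R (R ⧸ I ⊔ frobeniusPower p e (maximalIdeal R)) * (p ^ e : ℕ) ≤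
        (C * (p ^ e) ^ d : ℕ) := by
  rcases subsingleton_or_nontrivial (R ⧸ I) with h | h
  · refine ⟨0, fun e => ?_⟩
    rw [Ideal.Quotient.subsingleton_iff.1 h, top_sup_eq]
    simp [Module.length_eq_zero]
  obtain ⟨t, rfl⟩ : ∃ t, d = t + 1 := by
    refine Nat.exists_eq_succ_of_ne_zero ?_
    rintro rfl
    have := (add_le_add_left (ringKrullDim_nonneg_of_nontrivial (R := R ⧸ I)) 1).trans hd
    exact absurd this (by norm_num)
  obtain ⟨C, hC⟩ := exists_length_quotient_sup_frobeniusPower_le p I (t := t)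
    ((ENat.WithBot.add_le_add_natCast_right_iff (c := 1)).1 (by simpa using hd))
  refine ⟨C, fun e => (mul_le_mul_left (hC e) _).trans ?_⟩
  rw [pow_succ, ← mul_assoc, Nat.cast_mul _ (p ^ e)]

end SplittingLength

section NotDomain

variable (p : ℕ) [Fact p.Prime] {R : Type*} [CommRing R] [IsLocalRing R] [CharP R p]

theorem tendsto_splittingLength_of_not_isReduced (h : ¬ IsReduced R) (d : ℕ) :
    Tendsto (fun e => (splittingLength p R e : ℝ) / (p : ℝ) ^ (e * d)) atTop (𝓝 0) := by
  refine tendsto_const_nhds.congr' ?_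
  filter_upwards [eventually_ne_atTop 0] with e he
  rw [splittingLength, nonsplittingIdeal_eq_top_of_not_isReduced p e h he]
  simp [Module.length_eq_zero]

theorem exists_minimalPrimes_not_le {A : Type*} [CommRing A] [IsReduced A] [Nontrivial A]
    (h : ¬ IsDomain A) : ∃ P ∈ minimalPrimes A, ∃ Q ∈ minimalPrimes A, ¬ Q ≤ P := by
  by_contra! hcon
  obtain ⟨P, hP⟩ := Ideal.nonempty_minimalPrimes (I := (⊥ : Ideal A)) bot_ne_top
  have hbot : P = ⊥ := by
    refine eq_bot_iff.2 ((le_sInf fun Q hQ => hcon Q hQ P hP : P ≤ sInf (minimalPrimes A)).trans ?_)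
    rw [minimalPrimes, Ideal.sInf_minimalPrimes]
    exact (nilradical_eq_zero A).le
  have := Ideal.IsMinimalPrime.isPrime hP
  rw [hbot] at this
  exact h (IsDomain.of_bot_isPrime A)

theorem le_nonsplittingIdeal_of_mem_minimalPrimes {P : Ideal R} (hP : P ∈ minimalPrimes R) (e : ℕ) :
    P ≤ nonsplittingIdeal p e R := by
  intro x hx
  have zeroDivisor : x ∉ nonZeroDivisors R := fun hx' =>
    Set.disjoint_left.1 (Ideal.disjoint_nonZeroDivisors_of_mem_minimalPrimes hP) hx hx'
  rw [mem_nonZeroDivisors_iff_right] at zeroDivisor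
  push Not at zeroDivisor
  obtain ⟨b, hb, hb0⟩ := zeroDivisor
  exact mem_nonsplittingIdeal_of_mul_eq_zero p e hb0 hb

theorem ringKrullDim_quotient_sup_succ_le {A : Type*} [CommRing A] {P Q : Ideal A} [P.IsPrime]
    (h : ¬ Q ≤ P) : ringKrullDim (A ⧸ P ⊔ Q) + 1 ≤ ringKrullDim A := by
  obtain ⟨y, hyQ, hyP⟩ := Set.not_subset.1 h
  refine le_trans ?_ (ringKrullDim_quotient_le P)
  refine ringKrullDim_succ_le_of_surjective (Ideal.Quotient.factor le_sup_left)
    (Ideal.Quotient.factor_surjective le_sup_left) (r := Ideal.Quotient.mk P y)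
    (mem_nonZeroDivisors_of_ne_zero ?_) ?_
  · rwa [Ne, Ideal.Quotient.eq_zero_iff_mem]
  · rw [Ideal.Quotient.factor_mk, Ideal.Quotient.eq_zero_iff_mem]
    exact Ideal.mem_sup_right hyQ

theorem tendsto_splittingLength_of_le_nonsplittingIdeal [IsNoetherianRing R] (hF : IsFFinite p R)
    {I : Ideal R} (hI : ∀ e, I ≤ nonsplittingIdeal p e R) {d : ℕ}
    (hd : ringKrullDim (R ⧸ I) + 1 ≤ d) :
    Tendsto (fun e => (splittingLength p R e : ℝ) / (p : ℝ) ^ (e * d)) atTop (𝓝 0) := by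
  have hp : p.Prime := Fact.out
  obtain ⟨C, hC⟩ := exists_length_quotient_sup_frobeniusPower_mul_le p I hd
  have bound (e : ℕ) : splittingLength p R e * p ^ e ≤ C * (p ^ e) ^ d := by
    have := (mul_le_mul_left (length_quotient_anti (sup_le (hI e)
      (frobeniusPower_maximalIdeal_le_nonsplittingIdeal p e R))) _).trans (hC e)
    rw [← coe_splittingLength p hF] at this
    exact_mod_cast this
  refine squeeze_zero (fun e => by positivity) (fun e => ?_)
    (tendsto_const_nhds.div_atTop (tendsto_pow_atTop_atTop_of_one_lt (r := (p : ℝ))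
      (by exact_mod_cast hp.one_lt)) : Tendsto (fun e : ℕ => (C : ℝ) / (p : ℝ) ^ e) atTop (𝓝 0))
  have hp0 : (0 : ℝ) < p := by exact_mod_cast hp.pos
  rw [div_le_div_iff₀ (by positivity) (by positivity), pow_mul]
  exact_mod_cast bound e

theorem tendsto_splittingLength_of_not_isDomain [IsNoetherianRing R] [IsReduced R]
    (h : ¬ IsDomain R) (hF : IsFFinite p R) {d : ℕ} (hd : ringKrullDim R = d) :
    Tendsto (fun e => (splittingLength p R e : ℝ) / (p : ℝ) ^ (e * d)) atTop (𝓝 0) := by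
  obtain ⟨P, hP, Q, hQ, hPQ⟩ := exists_minimalPrimes_not_le h
  have := Ideal.IsMinimalPrime.isPrime hP
  exact tendsto_splittingLength_of_le_nonsplittingIdeal p hF
    (fun e => sup_le (le_nonsplittingIdeal_of_mem_minimalPrimes p hP e)
      (le_nonsplittingIdeal_of_mem_minimalPrimes p hQ e))
    ((ringKrullDim_quotient_sup_succ_le hPQ).trans hd.le)

end NotDomain

section Domain

open FrobeniusAlgebra

theorem exists_smul_mem_span_range (R M : Type*) [CommRing R] [IsDomain R] [AddCommGroup M]
    [Module R M] [Module.Finite R M] : ∃ (v : Fin (Module.finrank R M) → M) (c : R), c ≠ 0 ∧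
      ∀ x, c • x ∈ Submodule.span R (Set.range v) := by
  obtain ⟨v, hv⟩ := exists_linearIndependent_of_le_finrank (le_refl (Module.finrank R M))
  set N := Submodule.span R (Set.range v)
  have : Module.Finite R N := Module.Finite.span_of_finite R (Set.finite_range v)
  have torsion : Module.IsTorsion R (M ⧸ N) := by
    rw [← Module.finrank_eq_zero_iff_isTorsion]
    have finrank_N : Module.finrank R N = Module.finrank R M := by
      rw [finrank_span_eq_card hv, Fintype.card_fin]
    have additivity := rank_quotient_add_rank_of_isDomain N
    rw [← Module.finrank_eq_rank, ← Module.finrank_eq_rank, ← Module.finrank_eq_rank,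
      finrank_N] at additivity
    have : Module.finrank R (M ⧸ N) + Module.finrank R M = Module.finrank R M := by
      exact_mod_cast additivity
    omega
  obtain ⟨c, hc, hc0⟩ := Submodule.annihilator_top_inter_nonZeroDivisors torsion
  refine ⟨v, c, nonZeroDivisors.ne_zero hc0, fun x => ?_⟩
  rw [← Submodule.Quotient.mk_eq_zero, Submodule.Quotient.mk_smul]
  exact Submodule.mem_annihilator.1 hc _ trivial

variable (p : ℕ)

attribute [local instance] algebraSucc in
theorem FrobeniusAlgebra.exists_linearIndependent {R : Type*} [CommRing R] [ExpChar R p] {r : ℕ}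
    {v : Fin r → FrobeniusAlgebra p 1 R} (hv : LinearIndependent R v) (e : ℕ) :
    ∃ w : Fin (r ^ e) → FrobeniusAlgebra p e R, LinearIndependent R w := by
  induction e with
  | zero =>
    have : Subsingleton (Fin (r ^ 0)) := by rw [pow_zero]; infer_instance
    refine ⟨fun _ => ringEquiv p 0 R 1, Fintype.linearIndependent_iff.2 fun g hg i => ?_⟩
    rw [Fintype.sum_subsingleton _ i, smul_ringEquiv, pow_zero, pow_one, mul_one,
      map_eq_zero_iff _ (ringEquiv p 0 R).injective] at hg
    exact hg
  | succ e ih =>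
    obtain ⟨w, hw⟩ := ih
    have := isScalarTower_succ p e R
    let j : FrobeniusAlgebra p 1 R ≃+ FrobeniusAlgebra p (e + 1) R :=
      ((ringEquiv p 1 R).symm.trans (ringEquiv p (e + 1) R)).toAddEquiv
    have hv' : LinearIndependent (FrobeniusAlgebra p e R) (j ∘ v) := by
      refine hv.map_of_surjective_injective (ringEquiv p e R) j.toAddMonoidHom
        (ringEquiv p e R).surjective (fun _ => (map_eq_zero_iff j j.injective).1) fun a m => ?_
      obtain ⟨m, rfl⟩ := (ringEquiv p 1 R).surjective m
      change ringEquiv p (e + 1) R (a ^ p ^ 1 * m) = ringEquiv p (e + 1) R (a ^ p * m)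
      rw [pow_one]
    exact ⟨_, (linearIndependent_equiv finProdFinEquiv.symm).2 (linearIndependent_smul hw hv')⟩

variable [Fact p.Prime] {R : Type*} [CommRing R] [CharP R p] [IsLocalRing R] [IsNoetherianRing R]

theorem finrank_frobeniusAlgebra_one_le (hF : IsFFinite p R) {d : ℕ} (hd : ringKrullDim R = d) :
    Module.finrank R (FrobeniusAlgebra p 1 R) ≤ residueFrobeniusDegree p R * p ^ d := by
  set r := Module.finrank R (FrobeniusAlgebra p 1 R) with hr
  obtain ⟨v, hv⟩ := exists_linearIndependent_of_le_finrank hr.le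
  obtain ⟨C, hC⟩ := exists_length_quotient_sup_frobeniusPower_le p (⊥ : Ideal R) (t := d)
    ((ringKrullDim_quotient_le _).trans hd.le)
  refine le_of_pow_le_mul_pow (C := C) (mul_pos (residueFrobeniusDegree_pos p R hF)
    (pow_pos (Fact.out : p.Prime).pos d)) fun e => ?_
  have := finite_of_isFFinite p e R hF
  obtain ⟨w, hw⟩ := FrobeniusAlgebra.exists_linearIndependent p hv e
  have lower := card_le_length_quotient_maximalIdeal_smul_top hw
  rw [Ideal.smul_top_eq_map, (Submodule.Quotient.restrictScalarsEquiv R _).length_eq,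
    map_algebraMap_frobeniusAlgebra, length_quotient_frobeniusAlgebra p e R hF,
    Fintype.card_fin] at lower
  have upper := hC e
  rw [bot_sup_eq] at upper
  have : r ^ e ≤ C * (p ^ e) ^ d * residueFrobeniusDegree p R ^ e := by
    exact_mod_cast lower.trans (mul_le_mul_left upper _)
  exact this.trans_eq (by ring)

-- Up to torsion, `F_* R` is free of rank at most `[k : k ^ p] p ^ d`; tensoring with `R / I_e` and
-- using `I_e^[p] ≤ I_{e+1}` compares consecutive splitting lengths.
theorem exists_length_quotient_nonsplittingIdeal_succ_le [IsDomain R] (hF : IsFFinite p R) {d : ℕ}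
    (hd : ringKrullDim R = d) : ∃ (n : ℕ) (c : R), c ≠ 0 ∧ ∀ e : ℕ,
      Module.length R (R ⧸ nonsplittingIdeal p (e + 1) R) * residueFrobeniusDegree p R ≤
        (residueFrobeniusDegree p R * p ^ d : ℕ) * Module.length R (R ⧸ nonsplittingIdeal p e R) +
          n * Module.length R (R ⧸ Ideal.span {c} ⊔ frobeniusPower p e (maximalIdeal R)) := by
  have := finite_of_isFFinite p 1 R hF
  obtain ⟨v, c, hc0, hc⟩ := exists_smul_mem_span_range R (FrobeniusAlgebra p 1 R)
  obtain ⟨n, w, hw⟩ := Module.Finite.exists_fin (R := R) (M := FrobeniusAlgebra p 1 R)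
  refine ⟨n, c, hc0, fun e => ?_⟩
  have comparison := length_quotient_smul_top_le hw hc (nonsplittingIdeal p e R)
  rw [Ideal.smul_top_eq_map, (Submodule.Quotient.restrictScalarsEquiv R _).length_eq,
    map_algebraMap_frobeniusAlgebra, length_quotient_frobeniusAlgebra p 1 R hF, pow_one]
    at comparison
  have le_sup : Ideal.span {c} ⊔ frobeniusPower p e (maximalIdeal R) ≤
      nonsplittingIdeal p e R ⊔ Ideal.span {c} := by
    rw [sup_comm]
    exact sup_le_sup_right (frobeniusPower_maximalIdeal_le_nonsplittingIdeal p e R) _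
  refine ((mul_le_mul_left
    (length_quotient_anti (frobeniusPower_nonsplittingIdeal_le p e R)) _).trans comparison).trans ?_
  gcongr
  · exact finrank_frobeniusAlgebra_one_le p hF hd
  · exact length_quotient_anti le_sup

theorem exists_splittingLength_succ_mul_le [IsDomain R] (hF : IsFFinite p R) {d : ℕ}
    (hd : ringKrullDim R = d) : ∃ C : ℕ, ∀ e : ℕ,
      splittingLength p R (e + 1) * p ^ e ≤
        p ^ d * (splittingLength p R e * p ^ e + C * (p ^ e) ^ d) := by
  obtain ⟨n, c, hc0, hc⟩ := exists_length_quotient_nonsplittingIdeal_succ_le p hF hd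
  obtain ⟨C, hC⟩ := exists_length_quotient_sup_frobeniusPower_mul_le p (Ideal.span {c})
    ((ringKrullDim_quotient_succ_le_of_nonZeroDivisor
      (mem_nonZeroDivisors_of_ne_zero hc0)).trans hd.le)
  refine ⟨n * C, fun e => Nat.le_of_mul_le_mul_left ?_ (residueFrobeniusDegree_pos p R hF)⟩
  set κ := residueFrobeniusDegree p R
  have hκ : 1 ≤ κ * p ^ d := Nat.mul_pos (residueFrobeniusDegree_pos p R hF)
    (pow_pos (Fact.out : p.Prime).pos d)
  have hce := hc e
  rw [← coe_splittingLength p hF, ← coe_splittingLength p hF] at hce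
  have combined : (splittingLength p R (e + 1) * κ * p ^ e : ℕ∞) ≤
      κ * p ^ d * splittingLength p R e * p ^ e + n * (C * (p ^ e) ^ d : ℕ) :=
    calc (splittingLength p R (e + 1) * κ * p ^ e : ℕ∞)
        ≤ ((κ * p ^ d : ℕ) * splittingLength p R e +
          n * Module.length R (R ⧸ Ideal.span {c} ⊔ frobeniusPower p e (maximalIdeal R))) *
            p ^ e := by gcongr
      _ = κ * p ^ d * splittingLength p R e * p ^ e +
          n * (Module.length R (R ⧸ Ideal.span {c} ⊔ frobeniusPower p e (maximalIdeal R)) *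
            (p ^ e : ℕ)) := by push_cast; ring
      _ ≤ _ := by gcongr; exact hC e
  calc κ * (splittingLength p R (e + 1) * p ^ e)
      = splittingLength p R (e + 1) * κ * p ^ e := by ring
    _ ≤ κ * p ^ d * splittingLength p R e * p ^ e + n * (C * (p ^ e) ^ d) := by
        exact_mod_cast combined
    _ ≤ κ * p ^ d * splittingLength p R e * p ^ e + κ * p ^ d * (n * (C * (p ^ e) ^ d)) := by
        exact Nat.add_le_add_left (Nat.le_mul_of_pos_left _ hκ) _
    _ = _ := by ring

theorem tendsto_splittingLength_of_isDomain [IsDomain R] (hF : IsFFinite p R) {d : ℕ}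
    (hd : ringKrullDim R = d) : ∃ s : ℝ,
      Tendsto (fun e => (splittingLength p R e : ℝ) / (p : ℝ) ^ (e * d)) atTop (𝓝 s) := by
  have hp : p.Prime := Fact.out
  have hp0 : (0 : ℝ) < p := by exact_mod_cast hp.pos
  obtain ⟨C, hC⟩ := exists_splittingLength_succ_mul_le p hF hd
  refine tendsto_of_le_add_geometric (p := p) (C := C) (fun e => by positivity)
    (by exact_mod_cast hp.one_lt) (by positivity) fun e => ?_
  have step : (splittingLength p R (e + 1) : ℝ) * (p : ℝ) ^ e ≤
      (p : ℝ) ^ d * (splittingLength p R e * (p : ℝ) ^ e + C * ((p : ℝ) ^ e) ^ d) := by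
    exact_mod_cast hC e
  rw [add_mul, one_mul, pow_add, pow_mul, div_add_div _ _ (by positivity) (by positivity),
    div_le_div_iff₀ (by positivity) (by positivity)]
  calc (splittingLength p R (e + 1) : ℝ) * (((p : ℝ) ^ e) ^ d * (p : ℝ) ^ e)
      = splittingLength p R (e + 1) * (p : ℝ) ^ e * ((p : ℝ) ^ e) ^ d := by ring
    _ ≤ (p : ℝ) ^ d * (splittingLength p R e * (p : ℝ) ^ e + C * ((p : ℝ) ^ e) ^ d) *
        ((p : ℝ) ^ e) ^ d := by gcongr
    _ = _ := by ring

end Domain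

theorem exists_tendsto_splittingLength (p : ℕ) [Fact p.Prime] {R : Type*} [CommRing R]
    [IsLocalRing R] [IsNoetherianRing R] [CharP R p] (hF : IsFFinite p R) {d : ℕ}
    (hd : ringKrullDim R = d) : ∃ s : ℝ,
      Tendsto (fun e => (splittingLength p R e : ℝ) / (p : ℝ) ^ (e * d)) atTop (𝓝 s) := by
  by_cases hred : IsReduced R
  · by_cases hdom : IsDomain R
    · exact tendsto_splittingLength_of_isDomain p hF hd
    · exact ⟨0, tendsto_splittingLength_of_not_isDomain p hdom hF hd⟩
  · exact ⟨0, tendsto_splittingLength_of_not_isReduced p hred d⟩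

section FSignature

theorem IsFFinite.of_surjective {p : ℕ} {A B : Type*} [CommRing A] [ExpChar A p] [CommRing B]
    [ExpChar B p] (h : IsFFinite p A) {ρ : A →+* B} (hρ : Function.Surjective ρ) :
    IsFFinite p B := by
  have : Module.Finite A (FrobeniusPushforward p 1 A) := h
  have : RingHomSurjective ρ := ⟨hρ⟩
  let f : FrobeniusPushforward p 1 A →ₛₗ[ρ] FrobeniusPushforward p 1 B :=
    { toFun := fun x => FrobeniusPushforward.of p 1 B (ρ ((FrobeniusPushforward.of p 1 A).symm x))
      map_add' := fun x y => by simp only [map_add]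
      map_smul' := fun r x => by
        obtain ⟨x, rfl⟩ := (FrobeniusPushforward.of p 1 A).surjective x
        rw [FrobeniusPushforward.smul_def, AddEquiv.symm_apply_apply, AddEquiv.symm_apply_apply,
          FrobeniusPushforward.smul_def, map_mul, map_pow] }
  exact Module.Finite.of_surjective f ((FrobeniusPushforward.of p 1 B).surjective.comp
    (hρ.comp (FrobeniusPushforward.of p 1 A).symm.surjective))

variable {p : ℕ} [Fact p.Prime] {R : Type*} [CommRing R] [IsLocalRing R] [CharP R p]

theorem rpow_mul_frobeniusAlpha (h : IsFFinite p R) (e : ℕ) :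
    (p : ℝ) ^ ((e : ℝ) * frobeniusAlpha p R) = (residueFrobeniusDegree p R : ℝ) ^ e := by
  have hp : p.Prime := Fact.out
  rw [mul_comm, Real.rpow_mul (by positivity), Real.rpow_natCast, frobeniusAlpha,
    Real.rpow_logb (by exact_mod_cast hp.pos) (by exact_mod_cast hp.one_lt.ne')
      (by exact_mod_cast residueFrobeniusDegree_pos p R h)]

theorem fSplittingNumber_div_rpow (h : IsFFinite p R) (e : ℕ) :
    (fSplittingNumber p e R : ℝ) / (p : ℝ) ^ ((e : ℝ) * frobeniusAlpha p R) =
      splittingLength p R e := by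
  have hκ : (residueFrobeniusDegree p R : ℝ) ≠ 0 := by
    exact_mod_cast (residueFrobeniusDegree_pos p R h).ne'
  have fSplittingNumber_eq :
      fSplittingNumber p e R = splittingLength p R e * residueFrobeniusDegree p R ^ e := by
    have := fSplittingNumber_eq_length p e R h
    rw [← coe_splittingLength p h] at this
    exact_mod_cast this
  rw [rpow_mul_frobeniusAlpha h, fSplittingNumber_eq, Nat.cast_mul, Nat.cast_pow,
    mul_div_cancel_right₀ _ (pow_ne_zero e hκ)]

theorem isFSignature_of_tendsto_splittingLength (h : IsFFinite p R) {d : ℕ}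
    (hd : ringKrullDim R = d) {s : ℝ}
    (hs : Tendsto (fun e => (splittingLength p R e : ℝ) / (p : ℝ) ^ (e * d)) atTop (𝓝 s)) :
    IsFSignature p R s := by
  refine ⟨d, hd, hs.congr fun e => ?_⟩
  have hp0 : (0 : ℝ) < p := by exact_mod_cast (Fact.out : p.Prime).pos
  rw [← fSplittingNumber_div_rpow h, div_div, ← Real.rpow_natCast, ← Real.rpow_add hp0]
  congr 2
  push_cast
  ring

end FSignature

theorem corollary4p10 (p : ℕ) [Fact p.Prime] (S : Type*) [CommRing S] [IsRegularLocalRing S]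
    [CharP S p] (hS : IsFFinite p S) (J : Ideal S) [Nontrivial (S ⧸ J)]
    (d : ℕ) (hd : ringKrullDim (S ⧸ J) = d) :
    (∀ e : ℕ, 0 < e →
      Module.length S (S ⧸ fedderIdeal p e J) ≠ ⊤ ∧
      (fSplittingNumber p e (S ⧸ J) : ℝ) / (p : ℝ) ^ ((e : ℝ) * frobeniusAlpha p (S ⧸ J)) =
        (Module.length S (S ⧸ fedderIdeal p e J)).toNat ∧
      Module.length S (S ⧸ fedderIdeal p e J) = Module.length S (FedderQuotient p e J)) ∧
    ∃ s : ℝ, IsFSignature p (S ⧸ J) s ∧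
      Tendsto (fun e : ℕ =>
        ((Module.length S (S ⧸ fedderIdeal p e J)).toNat : ℝ) / (p : ℝ) ^ (e * d)) atTop (𝓝 s) ∧
      Tendsto (fun e : ℕ =>
        ((Module.length S (FedderQuotient p e J)).toNat : ℝ) / (p : ℝ) ^ (e * d)) atTop (𝓝 s) := by
  have hR : IsFFinite p (S ⧸ J) := hS.of_surjective Ideal.Quotient.mk_surjective
  have length_eq (e : ℕ) :
      Module.length S (S ⧸ fedderIdeal p e J) = splittingLength p (S ⧸ J) e := by
    rw [length_quotient_fedderIdeal p e S hS, coe_splittingLength p hR]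
  have duality (e : ℕ) : Module.length S (S ⧸ fedderIdeal p e J) =
      Module.length S (FedderQuotient p e J) := length_fedderQuotient p e J
  refine ⟨fun e _ => ⟨length_eq e ▸ ENat.natCast_ne_top _, ?_, duality e⟩, ?_⟩
  · rw [fSplittingNumber_div_rpow hR, length_eq, ENat.toNat_natCast]
  obtain ⟨s, hs⟩ := exists_tendsto_splittingLength p hR hd
  refine ⟨s, isFSignature_of_tendsto_splittingLength hR hd hs, ?_, ?_⟩
  · simpa only [length_eq, ENat.toNat_natCast] using hs
  · simpa only [← duality, length_eq, ENat.toNat_natCast] using hs
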